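/- Let $G$ be a connected (finite-dimensional, real) Lie group with Lie algebra $\mathfrak g$, and let $\mathcal D$ be a derivation of $\mathfrak g$. For an eigenvalue $\alpha\in\mathbb C$ of $\mathcal D$ let $\mathfrak g_\alpha$ be the corresponding generalized eigenspace (taken in the complexification of $\mathfrak g$), and let $$\mathfrak g^{+}=\bigoplus_{\operatorname{Re}\alpha>0}\mathfrak g_\alpha,\qquad \mathfrak g^{0}=\bigoplus_{\operatorname{Re}\alpha=0}\mathfrak g_\alpha,\qquad \mathfrak g^{-}=\bigoplus_{\operatorname{Re}\alpha<0}\mathfrak g_\alpha ,$$ each understood as the real subspace of those vectors of $\mathfrak g$ that lie in the indicated complex sum; these are Lie subalgebras of $\mathfrak g$. Let $G^{+}$, $G^{0}$, $G^{-}$, $G^{+,0}$, $G^{-,0}$ be the connected Lie subgroups of $G$ with Lie algebras $\mathfrak g^{+}$, $\mathfrak g^{0}$, $\mathfrak g^{-}$, $\mathfrak g^{+}\oplus\mathfrak g^{0}$, $\mathfrak g^{-}\oplus\mathfrak g^{0}$ respectively, i.e. the subgroups generated by the exponentials of these subalgebras. Suppose that $G^{0}$ is compact. Then: 1. if $\mathcal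 D$ is inner, i.e. $\mathcal D=\operatorname{ad}(X)$ for some $X\in\mathfrak g$, then $G=G^{0}$; 2. for every derivation $\mathcal D$, inner or not, $G=G^{+,0}G^{-}=G^{-,0}G^{+}$, where $AB=\{ab : a\in A,\ b\in B\}$. -/

import Mathlib

open scoped Manifold ContDiff Pointwise TensorProduct

noncomputable section

/-- A smooth real Lie group is of class `C^3`, which is what Mathlib asks for in order to put the
Lie bracket on its Lie algebra `GroupLieAlgebra I G`. -/
instance LieGroup.minSmoothnessThree
    {E : Type*} [NormedAddCommGroup E] [NormedSpace ℝ E]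
    {G : Type*} [TopologicalSpace G] [ChartedSpace E G] [Group G]
    [LieGroup 𝓘(ℝ, E) ∞ G] : LieGroup 𝓘(ℝ, E) (minSmoothness ℝ 3) G :=
  LieGroup.of_le (n := ∞) (by
    rw [minSmoothness_of_isRCLikeNormedField]
    exact WithTop.coe_le_coe.mpr le_top)

namespace DerivationSplitting

section LinearAlgebra

variable {L : Type*} [AddCommGroup L] [Module ℝ L]

/-- For an endomorphism `D` of a real vector space `L` and a set `s` of real numbers, the real
subspace `⨁ L_α`, the sum being over the complex eigenvalues `α` of `D` with `Re α ∈ s`: the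
vectors of `L` which lie, in the complexification `ℂ ⊗ L`, in the sum of the generalized
eigenspaces `{x | ∃ n, (D - α)^n x = 0}` with `Re α ∈ s`
(a complex number that is not an eigenvalue contributes the zero space). -/
def spectralPart (D : L →ₗ[ℝ] L) (s : Set ℝ) : Submodule ℝ L :=
  ((⨆ α : {z : ℂ // z.re ∈ s},
      Module.End.maxGenEigenspace (LinearMap.baseChange ℂ D) (α : ℂ)).restrictScalars ℝ).comap
    (TensorProduct.mk ℝ ℂ L 1)

/-- `𝔤⁺`: eigenvalues with positive real part. -/
def plusPart (D : L →ₗ[ℝ] L) : Submodule ℝ L := spectralPart D (Set.Ioi 0)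

/-- `𝔤⁰`: eigenvalues with zero real part. -/
def zeroPart (D : L →ₗ[ℝ] L) : Submodule ℝ L := spectralPart D {0}

/-- `𝔤⁻`: eigenvalues with negative real part. -/
def minusPart (D : L →ₗ[ℝ] L) : Submodule ℝ L := spectralPart D (Set.Iio 0)

end LinearAlgebra

section Group

variable {E : Type*} [NormedAddCommGroup E] [NormedSpace ℝ E]
  {G : Type*} [TopologicalSpace G] [ChartedSpace E G] [Group G]

/-- The set `exp 𝔥`: the points `exp X = γ 1`, for `X ∈ 𝔥` and `γ` the integral curve through
the identity of the left-invariant vector field with value `X` at the identity. -/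
def expImage (h : Submodule ℝ (GroupLieAlgebra 𝓘(ℝ, E) G)) : Set G :=
  {g : G | ∃ X ∈ h, ∃ γ : ℝ → G,
    IsMIntegralCurve (I := 𝓘(ℝ, E)) γ (mulInvariantVectorField (I := 𝓘(ℝ, E)) X) ∧
      γ 0 = 1 ∧ γ 1 = g}

/-- The connected Lie subgroup of `G` with Lie algebra `𝔥`: the subgroup generated by `exp 𝔥`. -/
def connectedSubgroup (h : Submodule ℝ (GroupLieAlgebra 𝓘(ℝ, E) G)) : Subgroup G :=
  Subgroup.closure (expImage h)

variable [CompleteSpace E] [LieGroup 𝓘(ℝ, E) ∞ G]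

/-- Derivations of the Lie algebra of `G`. -/
abbrev Derivations (E : Type*) [NormedAddCommGroup E] [NormedSpace ℝ E] [CompleteSpace E]
    (G : Type*) [TopologicalSpace G] [ChartedSpace E G] [Group G] [LieGroup 𝓘(ℝ, E) ∞ G] :=
  LieDerivation ℝ (GroupLieAlgebra 𝓘(ℝ, E) G) (GroupLieAlgebra 𝓘(ℝ, E) G)

/-- The derivation `D` is inner: `D = ad X` for some `X` in the Lie algebra. -/
def IsInner (D : Derivations E G) : Prop :=
  ∃ X : GroupLieAlgebra 𝓘(ℝ, E) G, ∀ Y : GroupLieAlgebra 𝓘(ℝ, E) G, D Y = ⁅X, Y⁆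

/-- `G⁺`, the connected Lie subgroup with Lie algebra `𝔤⁺`. -/
def groupPlus (D : Derivations E G) : Subgroup G :=
  connectedSubgroup (plusPart D.toLinearMap)

/-- `G⁰`, the connected Lie subgroup with Lie algebra `𝔤⁰`. -/
def groupZero (D : Derivations E G) : Subgroup G :=
  connectedSubgroup (zeroPart D.toLinearMap)

/-- `G⁻`, the connected Lie subgroup with Lie algebra `𝔤⁻`. -/
def groupMinus (D : Derivations E G) : Subgroup G :=
  connectedSubgroup (minusPart D.toLinearMap)

/-- `G^{+,0}`, the connected Lie subgroup with Lie algebra `𝔤⁺ ⊕ 𝔤⁰`. -/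
def groupPlusZero (D : Derivations E G) : Subgroup G :=
  connectedSubgroup (plusPart D.toLinearMap ⊔ zeroPart D.toLinearMap)

/-- `G^{-,0}`, the connected Lie subgroup with Lie algebra `𝔤⁻ ⊕ 𝔤⁰`. -/
def groupMinusZero (D : Derivations E G) : Subgroup G :=
  connectedSubgroup (minusPart D.toLinearMap ⊔ zeroPart D.toLinearMap)

end Group

end DerivationSplitting

end

open scoped Manifold ContDiff Pointwise TensorProduct

noncomputable section

set_option linter.unusedSectionVars false

/-! Replace `D` by the diagonal map `S` that multiplies by `r` on the sum of the generalized
eigenspaces with real part `r`. Brackets add real parts, so `S` is again a derivation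
(`weightMap_lie`); it has real weights, and its kernel is `𝔤⁰`, so it commutes with `ad 𝔤⁰` and with
`Ad G⁰`. Averaging over the compact group `G⁰` an inner product for which `S` is symmetric gives an
invariant inner product `Q` for which `S` is still symmetric and every `ad X`, `X ∈ 𝔤⁰`, is skew
(`exists_form_of_isCompact`).

If `D = ad X`, then `D X = 0` puts `X` in `𝔤⁰`, so `D` is `Q`-skew and its spectrum is imaginary
(`spectralPart_zero_of_skew`). Hence `𝔤⁰ = 𝔤`, and `G⁰ = G` because a connected group is generated
by exponentials.

For general `D`, one has `tr (S ∘ ad x) = 0` for all `x`: for nonzero weight `ad x` is a multiple of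
a commutator with `S`, and for weight zero a symmetric map is paired with a skew one. So the Killing
form satisfies `κ(S x, y) = tr (S ∘ ad [x, y]) = 0`, and all nonzero weight vectors lie in its
radical `K`. A weight-zero element of `K` is skew with `tr (ad k)² = 0`, so `ad k = 0`; elements of
nonzero weight are ad-nilpotent. With Cartan's criterion and Engel's theorem, `K` acts nilpotently
on `𝔤` (`exists_nilpotent_lieIdeal`).

The nilpotency gives `exp K ⊆ G^{≥0} G^{<0}`. For `k ∈ K` and `P` the projection to negative
weights, the equation `w' = [P w, w]`, `w 0 = k`, has a global solution because its Picard iteration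
stops (`exists_global_solution`). If `γ` starts at `1` with logarithmic derivative `-P w`, then `Ad
γ w = k` is constant and `exp (t k) γ t` has logarithmic derivative `w - P w`, of nonnegative
weight. So `exp k = (exp k · γ 1) · (γ 1)⁻¹` is the splitting (`expCurve_mem_mul`). Finally `G^{≥0}
G^{<0}` is stable under right multiplication by every `exp (t bᵢ)`, and these generate `G`
(`exists_mul_eq_of_nilpotent`). The second product is the first one for `-S`. -/

namespace DerivationSplitting

/-! ### Velocities of curves and differentials of self-maps. -/

section Calculus

variable {E : Type*} [NormedAddCommGroup E] [NormedSpace ℝ E]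
  {G : Type*} [TopologicalSpace G] [ChartedSpace E G]

/-- The manifold derivative of a self-map, seen as an endomorphism of the model space. -/
def tderiv (f : G → G) (x : G) : E →L[ℝ] E := mfderiv 𝓘(ℝ, E) 𝓘(ℝ, E) f x

/-- The curve `c` has velocity `v` at time `t`. -/
def HasVelocity (c : ℝ → G) (v : E) (t : ℝ) : Prop :=
  HasMFDerivAt 𝓘(ℝ, ℝ) 𝓘(ℝ, E) c t ((1 : ℝ →L[ℝ] ℝ).smulRight v : ℝ →L[ℝ] E)

theorem tderiv_comp {f g : G → G} {x y : G} (hy : f x = y)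
    (hg : MDifferentiableAt 𝓘(ℝ, E) 𝓘(ℝ, E) g y)
    (hf : MDifferentiableAt 𝓘(ℝ, E) 𝓘(ℝ, E) f x) :
    tderiv (E := E) (fun z => g (f z)) x = (tderiv g y).comp (tderiv f x) := by
  subst hy
  exact mfderiv_comp x hg hf

theorem HasVelocity.of_hasMFDerivAt {c : ℝ → G} {v : E} {t : ℝ} {L : ℝ →L[ℝ] E}
    (h : HasMFDerivAt 𝓘(ℝ, ℝ) 𝓘(ℝ, E) c t L) (hL : L 1 = v) : HasVelocity c v t := by
  have : (1 : ℝ →L[ℝ] ℝ).smulRight v = L := by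
    refine ContinuousLinearMap.ext_ring ?_
    simp [hL]
  unfold HasVelocity
  rw [this]
  exact h

theorem HasVelocity.comp {f : G → G} {c : ℝ → G} {v : E} {t : ℝ} {y : G} (hc : HasVelocity c v t)
    (hy : c t = y) (hf : MDifferentiableAt 𝓘(ℝ, E) 𝓘(ℝ, E) f y) :
    HasVelocity (fun s => f (c s)) (tderiv f y v) t := by
  subst hy
  refine HasVelocity.of_hasMFDerivAt (HasMFDerivAt.comp t hf.hasMFDerivAt hc) ?_
  change tderiv f (c t) ((1 : ℝ →L[ℝ] ℝ).smulRight v 1) = _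
  simp

end Calculus

/-! ### Left logarithmic derivatives and the adjoint action. -/

section LieGroup

variable {E : Type*} [NormedAddCommGroup E] [NormedSpace ℝ E]
  {G : Type*} [TopologicalSpace G] [ChartedSpace E G] [Group G]

variable (E) in
/-- The differential at `1` of the left translation by `g`. -/
def leftDeriv (g : G) : E →L[ℝ] E := tderiv (fun x => g * x) 1

variable (E) in
/-- The adjoint action. -/
def Ad (g : G) : E →L[ℝ] E := tderiv (fun x => g * x * g⁻¹) 1

/-- The left logarithmic derivative of `c` at time `t` is `u`. -/
def HasLogDeriv (c : ℝ → G) (u : E) (t : ℝ) : Prop :=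
  HasVelocity c (leftDeriv E (c t) u) t

variable [LieGroup 𝓘(ℝ, E) ∞ G]

theorem mdiff_mul_left (g x : G) : MDifferentiableAt 𝓘(ℝ, E) 𝓘(ℝ, E) (fun y : G => g * y) x :=
  (contMDiff_mul_left (I := 𝓘(ℝ, E)) (n := ∞)).contMDiffAt.mdifferentiableAt (by simp)

theorem mdiff_mul_right (g x : G) : MDifferentiableAt 𝓘(ℝ, E) 𝓘(ℝ, E) (fun y : G => y * g) x :=
  (contMDiff_mul_right (I := 𝓘(ℝ, E)) (n := ∞)).contMDiffAt.mdifferentiableAt (by simp)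

theorem mdiff_mul_left_right (g h x : G) :
    MDifferentiableAt 𝓘(ℝ, E) 𝓘(ℝ, E) (fun y : G => g * y * h) x :=
  ((contMDiff_mul_right (I := 𝓘(ℝ, E)) (n := ∞) (a := h)).comp
    (contMDiff_mul_left (a := g))).contMDiffAt.mdifferentiableAt (by simp)

theorem Ad_one : Ad E (1 : G) = ContinuousLinearMap.id ℝ E := by
  have : (fun x : G => 1 * x * 1⁻¹) = id := by ext; simp
  rw [Ad, this]
  exact mfderiv_id

theorem leftDeriv_one : leftDeriv E (1 : G) = ContinuousLinearMap.id ℝ E := by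
  have : (fun x : G => 1 * x) = id := by ext; simp
  rw [leftDeriv, this]
  exact mfderiv_id

theorem Ad_mul (g h : G) : Ad E (g * h) = (Ad E g).comp (Ad E h) := by
  rw [Ad, Ad, Ad, ← tderiv_comp (by simp) (mdiff_mul_left_right _ _ _)
    (mdiff_mul_left_right _ _ _)]
  congr 1
  ext x; group

theorem Ad_mul_apply (g h : G) (x : E) : Ad E (g * h) x = Ad E g (Ad E h x) := by
  rw [Ad_mul]; rfl

theorem Ad_inv_apply_self (g : G) (x : E) : Ad E g⁻¹ (Ad E g x) = x := by
  rw [← Ad_mul_apply]; simp [Ad_one]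

theorem Ad_self_apply_inv (g : G) (x : E) : Ad E g (Ad E g⁻¹ x) = x := by
  rw [← Ad_mul_apply]; simp [Ad_one]

theorem leftDeriv_mul (g h : G) :
    leftDeriv E (g * h) = (tderiv (fun x => g * x) h).comp (leftDeriv E h) := by
  rw [leftDeriv, leftDeriv, ← tderiv_comp (by simp) (mdiff_mul_left _ _) (mdiff_mul_left _ _)]
  congr 1
  ext x; group

/-- This is `a x b = (a b)(b⁻¹ x b)`, differentiated at `x = 1`; it is the source of the `Ad` term
in the product rule `HasLogDeriv.mul`. -/
theorem tderiv_mul_right_leftDeriv (a b : G) (u : E) :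
    tderiv (fun x => x * b) a (leftDeriv E a u) = leftDeriv E (a * b) (Ad E b⁻¹ u) := by
  rw [leftDeriv, leftDeriv, Ad, ← ContinuousLinearMap.comp_apply, ← ContinuousLinearMap.comp_apply,
    ← tderiv_comp (by simp) (mdiff_mul_right _ _) (mdiff_mul_left _ _),
    ← tderiv_comp (by simp) (mdiff_mul_left _ _) (mdiff_mul_left_right _ _ _)]
  congr 2
  ext x; group

theorem leftDeriv_inv_comp (g : G) :
    (tderiv (fun x => g⁻¹ * x) g).comp (leftDeriv E g) = ContinuousLinearMap.id ℝ E := by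
  rw [← leftDeriv_mul, inv_mul_cancel, leftDeriv_one]

theorem leftDeriv_injective (g : G) : Function.Injective (leftDeriv E g) := by
  intro x y h
  have := congrArg (tderiv (E := E) (fun x => g⁻¹ * x) g) h
  simpa only [← ContinuousLinearMap.comp_apply, leftDeriv_inv_comp,
    ContinuousLinearMap.id_apply] using this

theorem HasVelocity.mul {a b : ℝ → G} {v w : E} {t : ℝ}
    (ha : HasVelocity a v t) (hb : HasVelocity b w t) :
    HasVelocity (fun s => a s * b s)
      (tderiv (fun x => x * b t) (a t) v + tderiv (fun x => a t * x) (b t) w) t := by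
  have hm : MDifferentiableAt (𝓘(ℝ, E).prod 𝓘(ℝ, E)) 𝓘(ℝ, E) (fun p : G × G => p.1 * p.2)
      (a t, b t) := (contMDiff_mul 𝓘(ℝ, E) ∞).mdifferentiableAt (by simp)
  refine HasVelocity.of_hasMFDerivAt (HasMFDerivAt.comp (g := fun p : G × G => p.1 * p.2) t
    (f := fun s => (a s, b s)) hm.hasMFDerivAt (HasMFDerivAt.prodMk ha hb)) ?_
  have h := mfderiv_prod_eq_add_apply (v := (v, w)) hm
  refine Eq.trans ?_ h
  refine congrArg (mfderiv (𝓘(ℝ, E).prod 𝓘(ℝ, E)) 𝓘(ℝ, E) (fun p : G × G => p.1 * p.2)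
      (a t, b t)) (?_ : _ = ((v, w) : E × E))
  change ((1 : ℝ →L[ℝ] ℝ).smulRight v 1, (1 : ℝ →L[ℝ] ℝ).smulRight w 1) = _
  simp

theorem HasLogDeriv.mul {a b : ℝ → G} {u v : E} {t : ℝ}
    (ha : HasLogDeriv a u t) (hb : HasLogDeriv b v t) :
    HasLogDeriv (fun s => a s * b s) (Ad E (b t)⁻¹ u + v) t := by
  have h := HasVelocity.mul ha hb
  unfold HasLogDeriv
  convert h using 1
  rw [map_add, tderiv_mul_right_leftDeriv, leftDeriv_mul]
  rfl

theorem hasLogDeriv_const (g : G) (t : ℝ) : HasLogDeriv (fun _ => g) (0 : E) t := by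
  refine HasVelocity.of_hasMFDerivAt (hasMFDerivAt_const g t) ?_
  rw [map_zero]
  rfl

theorem HasVelocity.unique {c : ℝ → G} {v w : E} {t : ℝ} (h : HasVelocity c v t)
    (h' : HasVelocity c w t) : v = w := by
  have h1 : (1 : ℝ →L[ℝ] ℝ).smulRight v = (1 : ℝ →L[ℝ] ℝ).smulRight w :=
    hasMFDerivAt_unique h h'
  simpa using DFunLike.congr_fun h1 (1 : ℝ)

theorem HasLogDeriv.unique {c : ℝ → G} {v w : E} {t : ℝ} (h : HasLogDeriv c v t)
    (h' : HasLogDeriv c w t) : v = w :=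
  leftDeriv_injective _ (HasVelocity.unique h h')

theorem HasLogDeriv.inv {a : ℝ → G} {u : E} {t : ℝ} (ha : HasLogDeriv a u t) :
    HasLogDeriv (fun s => (a s)⁻¹) (-(Ad E (a t) u)) t := by
  have hd : MDifferentiableAt 𝓘(ℝ, E) 𝓘(ℝ, E) (fun x : G => x⁻¹) (a t) :=
    (contMDiff_inv 𝓘(ℝ, E) ∞).mdifferentiableAt (by simp)
  have h := HasVelocity.comp ha rfl hd
  set w := tderiv (fun x : G => x⁻¹) (a t) (leftDeriv E (a t) u)
  -- The velocity of the inverse curve is not computed: it is only written as a left translate, and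
  -- the product rule for `a a⁻¹ = 1` then determines it.
  have hw : w = leftDeriv E (a t)⁻¹ (tderiv (fun x : G => a t * x) (a t)⁻¹ w) := by
    have := leftDeriv_inv_comp (E := E) (a t)⁻¹
    have h1 : (tderiv (fun x : G => (a t)⁻¹ * x) 1).comp (tderiv (fun x : G => a t * x) (a t)⁻¹)
        = ContinuousLinearMap.id ℝ E := by
      rw [← tderiv_comp (by simp) (mdiff_mul_left _ _) (mdiff_mul_left _ _)]
      simp only [inv_mul_cancel_left]
      exact mfderiv_id
    exact (DFunLike.congr_fun h1 w).symm
  rw [hw] at h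
  have h2 : HasLogDeriv (fun s => (a s)⁻¹) (tderiv (fun x : G => a t * x) (a t)⁻¹ w) t := h
  have h3 := ha.mul h2
  simp only [mul_inv_cancel] at h3
  have := h3.unique (hasLogDeriv_const 1 t)
  rw [inv_inv] at this
  rwa [eq_neg_of_add_eq_zero_right this] at h2

theorem HasLogDeriv.const_mul {a : ℝ → G} {u : E} {t : ℝ} (g : G) (ha : HasLogDeriv a u t) :
    HasLogDeriv (fun s => g * a s) u t := by
  simpa using (hasLogDeriv_const (E := E) g t).mul ha

theorem HasLogDeriv.mul_const {a : ℝ → G} {u : E} {t : ℝ} (g : G) (ha : HasLogDeriv a u t) :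
    HasLogDeriv (fun s => a s * g) (Ad E g⁻¹ u) t := by
  simpa using ha.mul (hasLogDeriv_const (E := E) g t)

theorem HasLogDeriv.comp_real {a : ℝ → G} {u : E} {τ : ℝ → ℝ} {r t : ℝ}
    (ha : HasLogDeriv a u (τ t)) (hτ : HasDerivAt τ r t) :
    HasLogDeriv (fun s => a (τ s)) (r • u) t := by
  refine HasVelocity.of_hasMFDerivAt (HasMFDerivAt.comp t ha hτ.hasFDerivAt.hasMFDerivAt) ?_
  change (1 : ℝ →L[ℝ] ℝ).smulRight (leftDeriv E (a (τ t)) u)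
    ((ContinuousLinearMap.toSpanSingleton ℝ r : ℝ →L[ℝ] ℝ) (1 : ℝ)) = leftDeriv E (a (τ t)) (r • u)
  simp

end LieGroup

/-! ### Regularity of the adjoint action. -/

section AdjointSmooth

open Filter Topology

variable {E : Type*} [NormedAddCommGroup E] [NormedSpace ℝ E]
  {G : Type*} [TopologicalSpace G] [ChartedSpace E G] [Group G] [LieGroup 𝓘(ℝ, E) ∞ G]

theorem contMDiff_Ad : ContMDiff 𝓘(ℝ, E) 𝓘(ℝ, E →L[ℝ] E) 1 (fun g : G => Ad E g) := by
  intro g₀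
  have hf : ContMDiffAt (𝓘(ℝ, E).prod 𝓘(ℝ, E)) 𝓘(ℝ, E) ∞
      (Function.uncurry fun g x : G => g * x * g⁻¹) (g₀, 1) := by
    have : ContMDiff (𝓘(ℝ, E).prod 𝓘(ℝ, E)) 𝓘(ℝ, E) ∞ (fun p : G × G => p.1 * p.2 * p.1⁻¹) :=
      (contMDiff_fst.mul contMDiff_snd).mul contMDiff_fst.inv
    exact this.contMDiffAt
  have h := ContMDiffAt.mfderiv (m := 1) (fun g x : G => g * x * g⁻¹) (fun _ : G => (1 : G)) hf
    contMDiffAt_const (by norm_cast)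
  refine h.congr_of_eventuallyEq (Eventually.of_forall fun g => ?_)
  -- All conjugations fix `1`, so the coordinate changes on both tangent spaces are those of the
  -- preferred chart at its own centre, that is, the identity.
  have h1 := inTangentCoordinates_eq_mfderiv_comp (I := 𝓘(ℝ, E)) (I' := 𝓘(ℝ, E))
    (f := fun _ : G => (1 : G)) (g := fun g : G => g * 1 * g⁻¹)
    (ϕ := fun g => mfderiv 𝓘(ℝ, E) 𝓘(ℝ, E) (fun x : G => g * x * g⁻¹) 1) (x₀ := g₀) (x := g)
    (by simp) (by simp)
  refine Eq.trans ?_ h1.symm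
  rw [mfderivWithin_range_extChartAt_symm]
  have h2 : ∀ x y : G, x = 1 → y = 1 →
      (mfderiv 𝓘(ℝ, E) 𝓘(ℝ, E) (extChartAt 𝓘(ℝ, E) x) y : E →L[ℝ] E)
        = ContinuousLinearMap.id ℝ E := by
    rintro x y rfl rfl
    exact mfderiv_extChartAt_self
  have h3 := h2 (g₀ * 1 * g₀⁻¹) (g * 1 * g⁻¹) (by simp) (by simp)
  ext v
  exact (DFunLike.congr_fun h3 (Ad E g v)).symm

end AdjointSmooth

/-! ### The derivative of `Ad` is the Lie bracket, by computation in a chart at the identity. -/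

section Chart

open Filter Topology

variable {E : Type*} [NormedAddCommGroup E] [NormedSpace ℝ E]
  {G : Type*} [TopologicalSpace G] [ChartedSpace E G] [Group G] [LieGroup 𝓘(ℝ, E) ∞ G]

variable (E G) in
/-- The preferred chart at the identity. -/
abbrev chartOne : PartialEquiv G E := extChartAt 𝓘(ℝ, E) (1 : G)

variable (E G) in
/-- The multiplication read in the preferred chart at the identity. -/
def chartMul (p : E × E) : E :=
  chartOne E G ((chartOne E G).symm p.1 * (chartOne E G).symm p.2)

theorem chartOne_symm_one : (chartOne E G).symm (chartOne E G 1) = 1 := extChartAt_to_inv 1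

theorem contMDiffAt_chartOne_symm :
    ContMDiffAt 𝓘(ℝ, E) 𝓘(ℝ, E) ∞ (chartOne E G).symm (chartOne E G 1) :=
  (contMDiffOn_extChartAt_symm (1 : G)).contMDiffAt (extChartAt_target_mem_nhds 1)

theorem contDiffAt_chartMul :
    ContDiffAt ℝ 2 (chartMul E G) (chartOne E G 1, chartOne E G 1) := by
  have h1 : ContMDiffAt (𝓘(ℝ, E).prod 𝓘(ℝ, E)) 𝓘(ℝ, E) ∞
      (fun p : E × E => (chartOne E G).symm p.1 * (chartOne E G).symm p.2)
      (chartOne E G 1, chartOne E G 1) :=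
    (ContMDiffAt.comp (chartOne E G 1, chartOne E G 1) contMDiffAt_chartOne_symm
      contMDiffAt_fst).mul (ContMDiffAt.comp (chartOne E G 1, chartOne E G 1)
        contMDiffAt_chartOne_symm contMDiffAt_snd)
  have h2 : ContMDiffAt 𝓘(ℝ, E) 𝓘(ℝ, E) ∞ (chartOne E G)
      ((chartOne E G).symm (chartOne E G 1) * (chartOne E G).symm (chartOne E G 1)) := by
    rw [chartOne_symm_one, mul_one]
    exact contMDiffAt_extChartAt
  have h3 := ContMDiffAt.comp (chartOne E G 1, chartOne E G 1) h2 h1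
  rw [← modelWithCornersSelf_prod, chartedSpaceSelf_prod] at h3
  exact h3.contDiffAt.of_le (by norm_cast)

theorem eventually_symm_mem_source :
    ∀ᶠ p in 𝓝 (chartOne E G 1), p ∈ (chartOne E G).target ∧
      (chartOne E G).symm p ∈ (chartAt E (1 : G)).source := by
  filter_upwards [extChartAt_target_mem_nhds (I := 𝓘(ℝ, E)) (1 : G)] with p hp
  refine ⟨hp, ?_⟩
  simpa using (chartOne E G).map_target hp

theorem mdiff_chartOne {g : G} (hg : g ∈ (chartAt E (1 : G)).source) :
    MDifferentiableAt 𝓘(ℝ, E) 𝓘(ℝ, E) (chartOne E G) g :=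
  mdifferentiableAt_extChartAt hg

/-- The derivative of the preferred chart at the identity. -/
def chartDeriv (g : G) : E →L[ℝ] E := mfderiv 𝓘(ℝ, E) 𝓘(ℝ, E) (chartOne E G) g

theorem hasFDerivAt_chart_comp {f : G → G} {g : G} (hf1 : f 1 = g)
    (hf : MDifferentiableAt 𝓘(ℝ, E) 𝓘(ℝ, E) f 1) (hg : g ∈ (chartAt E (1 : G)).source) :
    HasFDerivAt (fun q => chartOne E G (f ((chartOne E G).symm q)))
      ((chartDeriv g).comp (tderiv f 1)) (chartOne E G 1) := by
  subst hf1
  have hs := (contMDiffAt_chartOne_symm (E := E) (G := G)).mdifferentiableAt (by simp)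
  have h1 : HasMFDerivAt 𝓘(ℝ, E) 𝓘(ℝ, E) (chartOne E G).symm (chartOne E G 1)
      (ContinuousLinearMap.id ℝ E) := by
    have h := hs.hasMFDerivAt
    have := mfderivWithin_range_extChartAt_symm (I := 𝓘(ℝ, E)) (x := (1 : G))
    rw [ModelWithCorners.range_eq_univ, mfderivWithin_univ] at this
    rw [this] at h
    exact h
  have h2 : HasMFDerivAt 𝓘(ℝ, E) 𝓘(ℝ, E) f ((chartOne E G).symm (chartOne E G 1))
      (tderiv (E := E) f 1 : E →L[ℝ] E) := by
    rw [chartOne_symm_one]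
    exact hf.hasMFDerivAt
  have h3 : HasMFDerivAt 𝓘(ℝ, E) 𝓘(ℝ, E) (chartOne E G)
      (f ((chartOne E G).symm (chartOne E G 1))) (chartDeriv (E := E) (f 1) : E →L[ℝ] E) := by
    rw [chartOne_symm_one]
    exact (mdiff_chartOne hg).hasMFDerivAt
  have h4 : HasMFDerivAt 𝓘(ℝ, E) 𝓘(ℝ, E) (f ∘ (chartOne E G).symm) (chartOne E G 1)
      (tderiv (E := E) f 1 : E →L[ℝ] E) := HasMFDerivAt.comp (chartOne E G 1) h2 h1
  exact (HasMFDerivAt.comp (chartOne E G 1) h3 h4).hasFDerivAt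

variable (E) in
/-- The derivative of left translation by `g` read in the preferred chart at the identity. -/
def chartLeft (g : G) : E →L[ℝ] E := (chartDeriv g).comp (leftDeriv E g)

theorem eventually_hasFDerivAt_chartMul_right :
    ∀ᶠ p in 𝓝 (chartOne E G 1), HasFDerivAt (fun q => chartMul E G (p, q))
      (chartLeft E ((chartOne E G).symm p)) (chartOne E G 1) := by
  filter_upwards [eventually_symm_mem_source (E := E) (G := G)] with p hp
  exact hasFDerivAt_chart_comp (mul_one _) (mdiff_mul_left _ _) hp.2

theorem eventually_hasFDerivAt_chartMul_left :
    ∀ᶠ p in 𝓝 (chartOne E G 1), HasFDerivAt (fun q => chartMul E G (q, p))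
      ((chartLeft E ((chartOne E G).symm p)).comp (Ad E ((chartOne E G).symm p)⁻¹))
        (chartOne E G 1) := by
  filter_upwards [eventually_symm_mem_source (E := E) (G := G)] with p hp
  have h := hasFDerivAt_chart_comp (one_mul ((chartOne E G).symm p))
    (mdiff_mul_right ((chartOne E G).symm p) 1) hp.2
  refine h.congr_fderiv (ContinuousLinearMap.ext fun v => ?_)
  have := tderiv_mul_right_leftDeriv (1 : G) ((chartOne E G).symm p) v
  rw [leftDeriv_one, one_mul] at this
  exact congrArg (chartDeriv ((chartOne E G).symm p)) this

theorem eventually_mpullback_mulInvariantVectorField (v : E) :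
    ∀ᶠ p in 𝓝 (chartOne E G 1), VectorField.mpullbackWithin 𝓘(ℝ, E) 𝓘(ℝ, E) (chartOne E G).symm
      (mulInvariantVectorField (I := 𝓘(ℝ, E)) (G := G) v) (Set.range 𝓘(ℝ, E)) p
      = chartLeft E ((chartOne E G).symm p) v := by
  filter_upwards [eventually_symm_mem_source (E := E) (G := G)] with p hp
  have hi := ContinuousLinearMap.inverse_eq
    (mfderivWithin_extChartAt_symm_comp_mfderiv_extChartAt (I := 𝓘(ℝ, E)) (x := (1 : G)) hp.1)
    (mfderiv_extChartAt_comp_mfderivWithin_extChartAt_symm (I := 𝓘(ℝ, E)) (x := (1 : G)) hp.1)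
  exact DFunLike.congr_fun hi _

variable (G) in
/-- The Lie bracket of the Lie algebra of `G`, on the model space. -/
def lieBr (v w : E) : E :=
  Bracket.bracket (L := GroupLieAlgebra 𝓘(ℝ, E) G) (M := GroupLieAlgebra 𝓘(ℝ, E) G) v w

/-- In the chart the left-invariant field of `v` is `p ↦ chartLeft p v`, and the chart has
derivative the identity at `1`, so the bracket becomes the bracket of vector fields on `E`. -/
theorem lieBr_eq_chart (v w : E) : lieBr G v w =
    fderiv ℝ (fun p => chartLeft E ((chartOne E G).symm p) w) (chartOne E G 1) v -
    fderiv ℝ (fun p => chartLeft E ((chartOne E G).symm p) v) (chartOne E G 1) w := by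
  have hid : ∀ x : E, chartLeft E ((chartOne E G).symm (chartOne E G 1)) x = x := by
    intro x
    rw [chartOne_symm_one, chartLeft, leftDeriv_one]
    exact DFunLike.congr_fun (mfderiv_extChartAt_self (I := 𝓘(ℝ, E)) (x := (1 : G))) x
  have h := VectorField.mlieBracketWithin_apply (I := 𝓘(ℝ, E))
    (V := mulInvariantVectorField (I := 𝓘(ℝ, E)) (G := G) v)
    (W := mulInvariantVectorField (I := 𝓘(ℝ, E)) (G := G) w) (s := Set.univ) (x₀ := (1 : G))
  have hself := mfderiv_extChartAt_self (I := 𝓘(ℝ, E)) (x := (1 : G))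
  have hinv : (mfderiv 𝓘(ℝ, E) 𝓘(ℝ, E) (chartOne E G) 1).inverse = ContinuousLinearMap.id ℝ E :=
    ContinuousLinearMap.inverse_eq (R := ℝ) (g := ContinuousLinearMap.id ℝ E)
      ((ContinuousLinearMap.comp_id _).trans hself) ((ContinuousLinearMap.id_comp _).trans hself)
  rw [hinv] at h
  refine Eq.trans h ?_
  have hv := eventually_mpullback_mulInvariantVectorField (G := G) v
  have hw := eventually_mpullback_mulInvariantVectorField (G := G) w
  refine Eq.trans (ContinuousLinearMap.id_apply ..) ?_
  rw [Set.preimage_univ, Set.univ_inter, ModelWithCorners.range_eq_univ]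
  refine Eq.trans (congrFun VectorField.lieBracketWithin_univ _) ?_
  rw [ModelWithCorners.range_eq_univ] at hv hw
  have := Filter.EventuallyEq.lieBracket_vectorField_eq (𝕜 := ℝ) hv hw
  refine Eq.trans this ?_
  rw [VectorField.lieBracket, hid, hid]

theorem fderiv_chartMul_eq :
    ∀ᶠ p in 𝓝 (chartOne E G 1), ∀ w, fderiv ℝ (chartMul E G) (p, chartOne E G 1) (0, w) =
      chartLeft E ((chartOne E G).symm p) w := by
  have h1 : ∀ᶠ p in 𝓝 (chartOne E G 1),
      DifferentiableAt ℝ (chartMul E G) (p, chartOne E G 1) := by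
    have h := (contDiffAt_chartMul (E := E) (G := G)).eventually (by simp)
    have hc : Tendsto (fun p : E => (p, chartOne E G 1)) (𝓝 (chartOne E G 1))
        (𝓝 (chartOne E G 1, chartOne E G 1)) := by
      exact (Continuous.prodMk_left (chartOne E G 1)).tendsto _
    filter_upwards [hc.eventually h] with p hp
    exact hp.differentiableAt (by simp)
  filter_upwards [h1, eventually_hasFDerivAt_chartMul_right (E := E) (G := G)] with p hp hq w
  have h2 := hp.hasFDerivAt.comp (chartOne E G 1) (hasFDerivAt_prodMk_right p (chartOne E G 1))
  exact DFunLike.congr_fun (h2.unique hq) w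

theorem fderiv_chartMul_eq' :
    ∀ᶠ p in 𝓝 (chartOne E G 1), ∀ w, fderiv ℝ (chartMul E G) (chartOne E G 1, p) (w, 0) =
      chartLeft E ((chartOne E G).symm p) (Ad E ((chartOne E G).symm p)⁻¹ w) := by
  have h1 : ∀ᶠ p in 𝓝 (chartOne E G 1),
      DifferentiableAt ℝ (chartMul E G) (chartOne E G 1, p) := by
    have h := (contDiffAt_chartMul (E := E) (G := G)).eventually (by simp)
    have hc : Tendsto (fun p : E => (chartOne E G 1, p)) (𝓝 (chartOne E G 1))
        (𝓝 (chartOne E G 1, chartOne E G 1)) := by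
      exact (Continuous.prodMk_right (chartOne E G 1)).tendsto _
    filter_upwards [hc.eventually h] with p hp
    exact hp.differentiableAt (by simp)
  filter_upwards [h1, eventually_hasFDerivAt_chartMul_left (E := E) (G := G)] with p hp hq w
  have h2 := HasFDerivAt.comp (f := fun e => (e, p)) (chartOne E G 1) hp.hasFDerivAt
    (hasFDerivAt_prodMk_left (chartOne E G 1) p)
  exact DFunLike.congr_fun (h2.unique hq) w

theorem differentiableAt_fderiv_chartMul :
    DifferentiableAt ℝ (fderiv ℝ (chartMul E G)) (chartOne E G 1, chartOne E G 1) :=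
  ((contDiffAt_chartMul (E := E) (G := G)).fderiv_right (m := 1)
    (by norm_num)).differentiableAt (by simp)

theorem fderiv_chartMul_comm (v w : E) :
    fderiv ℝ (fderiv ℝ (chartMul E G)) (chartOne E G 1, chartOne E G 1) (v, 0) (0, w) =
    fderiv ℝ (fderiv ℝ (chartMul E G)) (chartOne E G 1, chartOne E G 1) (0, w) (v, 0) :=
  (contDiffAt_chartMul (E := E) (G := G)).isSymmSndFDerivAt (by simp) _ _

/-- With `lieBr_eq_chart`, this makes the bracket the antisymmetrized mixed second derivative of the
multiplication. -/
theorem fderiv_chartLeft (v w : E) :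
    fderiv ℝ (fun p => chartLeft E ((chartOne E G).symm p) w) (chartOne E G 1) v =
      fderiv ℝ (fderiv ℝ (chartMul E G)) (chartOne E G 1, chartOne E G 1) (v, 0) (0, w) := by
  have h := HasFDerivAt.comp (f := fun e : E => (e, chartOne E G 1)) (chartOne E G 1)
    (differentiableAt_fderiv_chartMul (E := E) (G := G)).hasFDerivAt
    (hasFDerivAt_prodMk_left (chartOne E G 1) (chartOne E G 1))
  have h2 := h.clm_apply (hasFDerivAt_const ((0, w) : E × E) (chartOne E G 1))
  have h3 := h2.congr_of_eventuallyEq (f₁ := fun p => chartLeft E ((chartOne E G).symm p) w)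
    (fderiv_chartMul_eq.mono fun p hp => (hp w).symm)
  rw [h3.fderiv]
  simp

theorem mdifferentiable_Ad_apply (w : E) :
    MDifferentiable 𝓘(ℝ, E) 𝓘(ℝ, E) (fun g : G => Ad E g w) := by
  have : ContMDiff 𝓘(ℝ, E) 𝓘(ℝ, E) 1 (fun g : G => Ad E g w) :=
    contMDiff_Ad.clm_apply contMDiff_const
  exact this.mdifferentiable (by simp)

/-- With `m` the multiplication in the chart and `e` the image of `1`, the two partial differentials
satisfy `∂₂m(p, e) w = ∂₁m(e, p) (Ad p w)`, because `p x = (p x p⁻¹) p`. Differentiating in `p` at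
`e` along `v` gives `D²m (v,0)(0,w) = D²m (0,v)(w,0) + (dAd v) w`, and symmetry of `D²m` turns the
difference into the bracket. -/
theorem fderiv_Ad_chart (v w : E) :
    fderiv ℝ (fun p => Ad E ((chartOne E G).symm p) w) (chartOne E G 1) v = lieBr G v w := by
  have hF : DifferentiableAt ℝ (fun p => Ad E ((chartOne E G).symm p) w) (chartOne E G 1) := by
    rw [← mdifferentiableAt_iff_differentiableAt]
    exact MDifferentiableAt.comp (chartOne E G 1) (mdifferentiable_Ad_apply w _)
      ((contMDiffAt_chartOne_symm (E := E) (G := G)).mdifferentiableAt (by simp))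
  have h := HasFDerivAt.comp (f := fun e : E => (chartOne E G 1, e)) (chartOne E G 1)
    (differentiableAt_fderiv_chartMul (E := E) (G := G)).hasFDerivAt
    (hasFDerivAt_prodMk_right (chartOne E G 1) (chartOne E G 1))
  have h2 := h.clm_apply (hF.hasFDerivAt.prodMk (hasFDerivAt_const (0 : E) (chartOne E G 1)))
  have h3 := h2.congr_of_eventuallyEq (f₁ := fun p => chartLeft E ((chartOne E G).symm p) w) (by
    filter_upwards [fderiv_chartMul_eq' (E := E) (G := G)] with p hp
    change _ = fderiv ℝ (chartMul E G) (chartOne E G 1, p) (Ad E ((chartOne E G).symm p) w, 0)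
    rw [hp, Ad_inv_apply_self])
  have h5 : ∀ x, fderiv ℝ (chartMul E G) (chartOne E G 1, chartOne E G 1) (x, 0) = x := by
    intro x
    rw [fderiv_chartMul_eq'.self_of_nhds, chartOne_symm_one, inv_one, Ad_one, chartLeft,
      leftDeriv_one]
    exact DFunLike.congr_fun (mfderiv_extChartAt_self (I := 𝓘(ℝ, E)) (x := (1 : G))) x
  rw [lieBr_eq_chart, fderiv_chartLeft, fderiv_chartLeft, fderiv_chartMul_comm w v,
    ← fderiv_chartLeft, h3.fderiv, chartOne_symm_one, Ad_one]
  simp only [add_apply, ContinuousLinearMap.comp_apply,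
    ContinuousLinearMap.flip_apply, ContinuousLinearMap.prod_apply, zero_apply,
    ContinuousLinearMap.inr_apply, Function.comp, h5, ContinuousLinearMap.id_apply]
  abel

theorem hasMFDerivAt_chartOne_one :
    HasMFDerivAt 𝓘(ℝ, E) 𝓘(ℝ, E) (chartOne E G) 1 (ContinuousLinearMap.id ℝ E) := by
  have h := (mdiff_chartOne (E := E) (mem_chart_source E (1 : G))).hasMFDerivAt
  rw [mfderiv_extChartAt_self] at h
  exact h

theorem HasLogDeriv.hasDerivAt_Ad_of_eq_one {c : ℝ → G} {u : E} {t : ℝ} (hc : HasLogDeriv c u t)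
    (h1 : c t = 1) (w : E) : HasDerivAt (fun s => Ad E (c s) w) (lieBr G u w) t := by
  have hF : DifferentiableAt ℝ (fun p => Ad E ((chartOne E G).symm p) w) (chartOne E G 1) := by
    rw [← mdifferentiableAt_iff_differentiableAt]
    exact MDifferentiableAt.comp (chartOne E G 1) (mdifferentiable_Ad_apply w _)
      ((contMDiffAt_chartOne_symm (E := E) (G := G)).mdifferentiableAt (by simp))
  have hv : HasMFDerivAt 𝓘(ℝ, ℝ) 𝓘(ℝ, E) c t ((1 : ℝ →L[ℝ] ℝ).smulRight u : ℝ →L[ℝ] E) := by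
    have : HasVelocity c (leftDeriv E (c t) u) t := hc
    rw [h1, leftDeriv_one] at this
    exact this
  have hφ : HasMFDerivAt 𝓘(ℝ, E) 𝓘(ℝ, E) (chartOne E G) (c t)
      (ContinuousLinearMap.id ℝ E : E →L[ℝ] E) := by
    rw [h1]; exact hasMFDerivAt_chartOne_one
  have h2 : HasMFDerivAt 𝓘(ℝ, ℝ) 𝓘(ℝ, E) (chartOne E G ∘ c) t
    ((1 : ℝ →L[ℝ] ℝ).smulRight u : ℝ →L[ℝ] E) := HasMFDerivAt.comp t hφ hv
  have h3 : HasDerivAt (chartOne E G ∘ c) u t := by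
    have h2' : HasFDerivAt (chartOne E G ∘ c) ((1 : ℝ →L[ℝ] ℝ).smulRight u) t := h2.hasFDerivAt
    simpa using h2'.hasDerivAt
  have h4 : HasFDerivAt (fun p => Ad E ((chartOne E G).symm p) w)
      (fderiv ℝ (fun p => Ad E ((chartOne E G).symm p) w) (chartOne E G 1))
      ((chartOne E G ∘ c) t) := by
    rw [Function.comp_apply, h1]; exact hF.hasFDerivAt
  have h5 := h4.comp_hasDerivAt t h3
  rw [fderiv_Ad_chart] at h5
  refine h5.congr_of_eventuallyEq ?_
  have hcont : ContinuousAt c t := hv.continuousAt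
  have hmem : ∀ᶠ s in 𝓝 t, c s ∈ (chartOne E G).source :=
    hcont.eventually (by rw [h1]; exact extChartAt_source_mem_nhds 1)
  filter_upwards [hmem] with s hs
  simp only [Function.comp]
  rw [(chartOne E G).left_inv hs]

/-- Left translation by `(c t)⁻¹` keeps the logarithmic derivative and brings the point to `1`; the
factor `Ad (c t)` is then put back. -/
theorem HasLogDeriv.hasDerivAt_Ad_const {c : ℝ → G} {u : E} {t : ℝ} (hc : HasLogDeriv c u t)
    (w : E) : HasDerivAt (fun s => Ad E (c s) w) (Ad E (c t) (lieBr G u w)) t := by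
  have h := (Ad E (c t)).hasFDerivAt.comp_hasDerivAt t
    ((hc.const_mul (c t)⁻¹).hasDerivAt_Ad_of_eq_one (by simp) w)
  refine h.congr_of_eventuallyEq (Eventually.of_forall fun s => ?_)
  simp [← Ad_mul_apply]

theorem HasLogDeriv.hasDerivAt_Ad {c : ℝ → G} {u : E} {t : ℝ} (hc : HasLogDeriv c u t)
    {w : ℝ → E} {w' : E} (hw : HasDerivAt w w' t) :
    HasDerivAt (fun s => Ad E (c s) (w s)) (Ad E (c t) (lieBr G u (w t) + w')) t := by
  have hv : HasMFDerivAt 𝓘(ℝ, ℝ) 𝓘(ℝ, E) c t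
    ((1 : ℝ →L[ℝ] ℝ).smulRight (leftDeriv E (c t) u) : ℝ →L[ℝ] E) := hc
  have h1 : DifferentiableAt ℝ (fun s => Ad E (c s)) t := by
    rw [← mdifferentiableAt_iff_differentiableAt]
    have hA : MDifferentiableAt 𝓘(ℝ, E) 𝓘(ℝ, E →L[ℝ] E) (fun g : G => Ad E g) (c t) :=
      (contMDiff_Ad (E := E) (G := G)).mdifferentiable (by simp) (c t)
    exact MDifferentiableAt.comp t hA hv.mdifferentiableAt
  have h2 := h1.hasDerivAt.clm_apply hw
  have h3 := (h1.hasDerivAt.clm_apply (hasDerivAt_const t (w t))).unique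
    (hc.hasDerivAt_Ad_const (w t))
  rw [map_zero, add_zero] at h3
  rwa [h3, ← map_add] at h2

end Chart

/-! ### Uniqueness of curves with given logarithmic derivative, and one-parameter subgroups. -/

section Exponential

open Filter Topology Set

variable {E : Type*} [NormedAddCommGroup E] [NormedSpace ℝ E] [CompleteSpace E]
  {G : Type*} [TopologicalSpace G] [T2Space G] [ChartedSpace E G] [Group G]
  [LieGroup 𝓘(ℝ, E) ∞ G]

theorem contMDiff_leftInvariant (X : GroupLieAlgebra 𝓘(ℝ, E) G) :
    ContMDiff 𝓘(ℝ, E) 𝓘(ℝ, E).tangent 1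
      (fun g : G => (⟨g, mulInvariantVectorField (I := 𝓘(ℝ, E)) X g⟩ : TangentBundle 𝓘(ℝ, E) G)) :=
  (contMDiff_mulInvariantVectorField X).of_le (by simp)

/-- Such a curve and a constant curve are both integral curves of the zero field, and integral
curves are unique. -/
theorem HasLogDeriv.eq_const {a : ℝ → G} {p q : ℝ}
    (ha : ∀ t ∈ Ioo p q, HasLogDeriv a (0 : E) t) {s t : ℝ} (hs : s ∈ Ioo p q) (ht : t ∈ Ioo p q) :
    a t = a s := by
  have h1 : IsMIntegralCurveOn (I := 𝓘(ℝ, E)) a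
      (mulInvariantVectorField (I := 𝓘(ℝ, E)) (0 : GroupLieAlgebra 𝓘(ℝ, E) G)) (Ioo p q) :=
    fun t ht => HasMFDerivAt.hasMFDerivWithinAt (ha t ht)
  have h2 : IsMIntegralCurveOn (I := 𝓘(ℝ, E)) (fun _ => a s)
      (mulInvariantVectorField (I := 𝓘(ℝ, E)) (0 : GroupLieAlgebra 𝓘(ℝ, E) G)) (Ioo p q) :=
    fun t _ => HasMFDerivAt.hasMFDerivWithinAt (hasLogDeriv_const (E := E) (a s) t)
  exact isMIntegralCurveOn_Ioo_eqOn_of_contMDiff_boundaryless hs (contMDiff_leftInvariant 0)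
    h1 h2 rfl ht

/-- Two curves with the same left logarithmic derivative differ by a left translation. -/
theorem HasLogDeriv.eq_translate {a b : ℝ → G} {u : ℝ → E} {p q : ℝ}
    (ha : ∀ t ∈ Ioo p q, HasLogDeriv a (u t) t) (hb : ∀ t ∈ Ioo p q, HasLogDeriv b (u t) t)
    {s t : ℝ} (hs : s ∈ Ioo p q) (ht : t ∈ Ioo p q) : a t = a s * (b s)⁻¹ * b t := by
  have h : ∀ t ∈ Ioo p q, HasLogDeriv (fun s => a s * (b s)⁻¹) (0 : E) t := by
    intro t ht
    have := (ha t ht).mul (hb t ht).inv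
    rwa [inv_inv, add_neg_cancel] at this
  have := HasLogDeriv.eq_const h hs ht
  rw [← this]; simp

/-- Left translates of one local integral curve through `1` provide the same existence time at every
point, so the left-invariant field is complete. -/
theorem exists_one_parameter (X : E) :
    ∃ γ : ℝ → G, γ 0 = 1 ∧ ∀ t, HasLogDeriv γ X t := by
  have hv := contMDiff_leftInvariant (E := E) (G := G) X
  obtain ⟨γ, h0, hγ⟩ := exists_isMIntegralCurveAt_of_contMDiffAt_boundaryless 0
    (hv.contMDiffAt (x := (1 : G)))
  obtain ⟨ε, hε, hball⟩ := Metric.eventually_nhds_iff.1 hγ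
  refine exists_isMIntegralCurve_of_isMIntegralCurveOn hv hε (fun x => ⟨fun t => x * γ t, ?_, ?_⟩) 1
  · simp [h0]
  · intro t ht
    have h1 : HasLogDeriv γ X t := hball (by rw [Real.dist_eq, sub_zero, abs_lt]; exact ht)
    exact HasMFDerivAt.hasMFDerivWithinAt (h1.const_mul x)

variable (G) in
/-- The one-parameter subgroup `t ↦ exp (t X)`. -/
def expCurve (X : E) : ℝ → G := (exists_one_parameter X).choose

theorem expCurve_zero (X : E) : expCurve G X 0 = 1 := (exists_one_parameter X).choose_spec.1

theorem hasLogDeriv_expCurve (X : E) (t : ℝ) : HasLogDeriv (expCurve G X) X t :=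
  (exists_one_parameter X).choose_spec.2 t

theorem eq_expCurve {X : E} {γ : ℝ → G} (h0 : γ 0 = 1) (h : ∀ t, HasLogDeriv γ X t) :
    γ = expCurve G X := by
  ext t
  obtain ⟨T, hT⟩ := exists_abs_lt t
  have hT' := abs_lt.1 hT.2
  have := HasLogDeriv.eq_translate (u := fun _ => X) (p := -T) (q := T) (fun t _ => h t)
    (fun t _ => hasLogDeriv_expCurve X t) (s := 0) ⟨by linarith, hT.1⟩ hT'
  rw [this, h0, expCurve_zero]; simp

theorem expCurve_smul (X : E) (r t : ℝ) : expCurve G (r • X) t = expCurve G X (r * t) := by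
  have := eq_expCurve (X := r • X) (γ := fun t => expCurve G X (r * t))
    (by simp [expCurve_zero]) (fun t => by
      have h : HasDerivAt (fun t : ℝ => r * t) r t := by simpa using (hasDerivAt_id t).const_mul r
      exact (hasLogDeriv_expCurve X (r * t)).comp_real h)
  exact (congrFun this t).symm

theorem conj_expCurve (g : G) (X : E) (t : ℝ) :
    g * expCurve G X t * g⁻¹ = expCurve G (Ad E g X) t := by
  have := eq_expCurve (X := Ad E g X) (γ := fun t => g * expCurve G X t * g⁻¹)
    (by simp [expCurve_zero]) (fun t => by
      simpa using ((hasLogDeriv_expCurve X t).const_mul g).mul_const g⁻¹)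
  exact congrFun this t

theorem mem_expImage_iff {h : Submodule ℝ (GroupLieAlgebra 𝓘(ℝ, E) G)} {g : G} :
    g ∈ expImage h ↔ ∃ X : E, X ∈ h ∧ expCurve G X 1 = g := by
  constructor
  · rintro ⟨X, hX, γ, hγ, h0, h1⟩
    have := eq_expCurve (E := E) (X := X) h0 hγ
    exact ⟨X, hX, by rw [← this, h1]⟩
  · rintro ⟨X, hX, hg⟩
    exact ⟨X, hX, expCurve G X, fun t => hasLogDeriv_expCurve X t, expCurve_zero X, hg⟩

theorem expCurve_mem_connectedSubgroup {h : Submodule ℝ (GroupLieAlgebra 𝓘(ℝ, E) G)} {X : E}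
    (hX : X ∈ h) (t : ℝ) : expCurve G X t ∈ connectedSubgroup h := by
  refine Subgroup.subset_closure (mem_expImage_iff.2 ⟨t • X, ?_, ?_⟩)
  · exact h.smul_mem t hX
  · rw [expCurve_smul, mul_one]

end Exponential

/-! ### `Ad ∘ exp` is `exp ∘ ad`. -/

section AdExp

variable {E : Type*} [NormedAddCommGroup E] [NormedSpace ℝ E] [CompleteSpace E]
  [FiniteDimensional ℝ E]
  {G : Type*} [TopologicalSpace G] [T2Space G] [ChartedSpace E G] [Group G]
  [LieGroup 𝓘(ℝ, E) ∞ G]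

variable (G) in
/-- The adjoint action of the Lie algebra of `G`, on the model space. -/
def adL (X : E) : E →L[ℝ] E :=
  LinearMap.toContinuousLinearMap
    { toFun := lieBr G X
      map_add' := fun v w => lie_add (L := GroupLieAlgebra 𝓘(ℝ, E) G)
        (M := GroupLieAlgebra 𝓘(ℝ, E) G) X v w
      map_smul' := fun r v => lie_smul (L := GroupLieAlgebra 𝓘(ℝ, E) G)
        (M := GroupLieAlgebra 𝓘(ℝ, E) G) r X v }

theorem adL_apply (X Y : E) : adL G X Y = lieBr G X Y := rfl

/-- The curve `Ad (exp tX) (e^{-t ad X} w)` has zero derivative, so it keeps its value `w` at `t =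
0`. -/
theorem Ad_expCurve (X : E) (t : ℝ) :
    Ad E (expCurve G X t) = NormedSpace.exp (t • adL G X) := by
  have hconst : ∀ w : E, ∀ t : ℝ, HasDerivAt
      (fun s => Ad E (expCurve G X s) (NormedSpace.exp ((-s) • adL G X) w)) 0 t := by
    intro w t
    have h1 : HasDerivAt (fun s : ℝ => NormedSpace.exp ((-s) • adL G X))
        (-(adL G X * NormedSpace.exp ((-t) • adL G X))) t := by
      have := (hasDerivAt_exp_smul_const' (𝕂 := ℝ) (adL G X) (-t)).scomp t (hasDerivAt_neg t)
      refine HasDerivAt.congr_deriv (f' := _) this (by simp)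
    have h2 := h1.clm_apply (hasDerivAt_const t w)
    have h3 := (hasLogDeriv_expCurve (G := G) X t).hasDerivAt_Ad h2
    convert h3 using 1
    simp [← adL_apply]
  have h : ∀ w : E, Ad E (expCurve G X t) (NormedSpace.exp ((-t) • adL G X) w) = w := by
    intro w
    have := is_const_of_deriv_eq_zero (fun t => (hconst w t).differentiableAt)
      (fun t => (hconst w t).deriv) t 0
    simpa [expCurve_zero, Ad_one] using this
  ext w
  have := h (NormedSpace.exp (t • adL G X) w)
  rw [← this]
  congr 1
  let _ : NormedAlgebra ℚ (E →L[ℝ] E) := NormedAlgebra.restrictScalars ℚ ℝ (E →L[ℝ] E)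
  rw [← mul_apply_eq_comp, ← NormedSpace.exp_add_of_commute]
  · simp
  · exact ((Commute.refl (adL G X)).smul_left _).smul_right _

theorem exp_apply_mem {A : E →L[ℝ] E} {p : Submodule ℝ E} (hA : ∀ x ∈ p, A x ∈ p) {x : E}
    (hx : x ∈ p) : NormedSpace.exp A x ∈ p := by
  have h := NormedSpace.exp_series_hasSum_exp' (𝕂 := ℝ) A
  have h2 := (ContinuousLinearMap.apply ℝ E x).hasSum h
  have hc : IsClosed (p : Set E) := p.closed_of_finiteDimensional
  refine hc.mem_of_tendsto h2 (Filter.Eventually.of_forall fun s => ?_)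
  refine p.sum_mem fun n _ => ?_
  have : ∀ n : ℕ, (A ^ n) x ∈ p := by
    intro n
    induction n with
    | zero => simpa
    | succ n ih => rw [pow_succ']; exact hA _ ih
  simpa using p.smul_mem _ (this n)

end AdExp

/-! ### Curves tangent to a subalgebra, and the subgroup that contains them. -/

section LocalCurves

open Filter Topology Set
open scoped NNReal

variable {E : Type*} [NormedAddCommGroup E] [NormedSpace ℝ E] [CompleteSpace E]
  [FiniteDimensional ℝ E]
  {G : Type*} [TopologicalSpace G] [T2Space G] [ChartedSpace E G] [Group G]
  [LieGroup 𝓘(ℝ, E) ∞ G]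

variable (G) in
/-- The subgroup generated by the one-parameter subgroups in the directions `e i`. -/
def expClosure {ι : Type*} (e : ι → E) : Subgroup G :=
  Subgroup.closure {g | ∃ i t, g = expCurve G (e i) t}

theorem expCurve_mem_expClosure {ι : Type*} (e : ι → E) (i : ι) (t : ℝ) :
    expCurve G (e i) t ∈ expClosure G e :=
  Subgroup.subset_closure ⟨i, t, rfl⟩

theorem Ad_expCurve_inv (X : E) (t : ℝ) :
    Ad E (expCurve G X t)⁻¹ = NormedSpace.exp ((-t) • adL G X) := by
  have h : ∀ w, Ad E (expCurve G X t) (NormedSpace.exp ((-t) • adL G X) w) = w := by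
    intro w
    rw [Ad_expCurve]
    let _ : NormedAlgebra ℚ (E →L[ℝ] E) := NormedAlgebra.restrictScalars ℚ ℝ (E →L[ℝ] E)
    rw [← mul_apply_eq_comp, ← NormedSpace.exp_add_of_commute]
    · simp
    · exact ((Commute.refl (adL G X)).smul_left _).smul_right _
  ext w
  rw [← h w, Ad_inv_apply_self, h]

/-- Coordinates of the second kind, with their left logarithmic derivative. -/
theorem exists_second_kind_coordinates {ι : Type*} [Fintype ι] [DecidableEq ι] (e : ι → E)
    {h : Submodule ℝ E} (he : ∀ i, e i ∈ h) (hlie : ∀ x ∈ h, ∀ y ∈ h, lieBr G x y ∈ h)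
    (s : Finset ι) :
    ∃ (M : (ι → ℝ) → (ι → ℝ) →L[ℝ] E) (F : (ι → ℝ) → G), ContDiff ℝ 1 M ∧
      (M 0 = ∑ i ∈ s, (ContinuousLinearMap.proj i : (ι → ℝ) →L[ℝ] ℝ).smulRight (e i)) ∧
      (∀ τ v, M τ v ∈ h) ∧ (∀ τ, F τ ∈ expClosure G e) ∧
      ∀ (τ : ℝ → ι → ℝ) (τ' : ι → ℝ) (t : ℝ), HasDerivAt τ τ' t →
        HasLogDeriv (fun t => F (τ t)) (M (τ t) τ') t := by
  induction s using Finset.induction_on with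
  | empty =>
    refine ⟨fun _ => 0, fun _ => 1, contDiff_const, by simp, by simp, fun _ => one_mem _, ?_⟩
    intro τ τ' t _
    exact hasLogDeriv_const 1 t
  | insert i s hi ih =>
    obtain ⟨M, F, hM, hM0, hMh, hF, hd⟩ := ih
    -- Multiplying on the right by `exp (τᵢ eᵢ)` twists the previous logarithmic derivative by `Ad
    -- (exp (τᵢ eᵢ))⁻¹ = e^{-τᵢ ad eᵢ}` and adds `τᵢ' eᵢ`.
    refine ⟨fun τ => (NormedSpace.exp ((-(τ i)) • adL G (e i))).comp (M τ) +
      (ContinuousLinearMap.proj i : (ι → ℝ) →L[ℝ] ℝ).smulRight (e i),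
      fun τ => F τ * expCurve G (e i) (τ i), ?_, ?_, ?_, ?_, ?_⟩
    · refine ContDiff.add (ContDiff.clm_comp ?_ hM) contDiff_const
      have h1 : ContDiff ℝ 1 (NormedSpace.exp : (E →L[ℝ] E) → (E →L[ℝ] E)) :=
        contDiff_iff_contDiffAt.2 fun x => (NormedSpace.exp_analytic (𝕂 := ℝ) x).contDiffAt
      have h2 : ContDiff ℝ 1 (fun τ : ι → ℝ => (-(τ i)) • adL G (e i)) := by fun_prop
      exact h1.comp h2
    · rw [Finset.sum_insert hi, ← hM0, add_comm]
      simp only [Pi.zero_apply, neg_zero, zero_smul, NormedSpace.exp_zero]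
      rfl
    · intro τ v
      refine h.add_mem (exp_apply_mem (fun x hx => ?_) (hMh τ v)) (h.smul_mem _ (he i))
      exact h.smul_mem _ (hlie _ (he i) _ hx)
    · exact fun τ => mul_mem (hF τ) (expCurve_mem_expClosure e i _)
    · intro τ τ' t hτ
      have h1 := hd τ τ' t hτ
      have h2 := (hasLogDeriv_expCurve (G := G) (e i) (τ t i)).comp_real
        (τ := fun t => τ t i) (hasDerivAt_pi.1 hτ i)
      have h3 := h1.mul h2
      rw [Ad_expCurve_inv] at h3
      exact h3

/-- Near `0` the operator `N` is invertible, so the implicit equation reads `α' = N(α)⁻¹ f(t)` with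
`α t₀ = 0`. The right side is Lipschitz in `α` and continuous in `t`, which is what Picard–Lindelöf
requires. -/
theorem exists_local_ode {F : Type*} [NormedAddCommGroup F] [NormedSpace ℝ F] [CompleteSpace F]
    {N : F → F →L[ℝ] F} (hN : ContDiff ℝ 1 N) (hN0 : N 0 = 1) {f : ℝ → F} {t₀ : ℝ}
    (hf : ∀ᶠ t in 𝓝 t₀, ContinuousAt f t) :
    ∃ (α : ℝ → F) (α' : ℝ → F), ∀ᶠ t in 𝓝 t₀, HasDerivAt α (α' t) t ∧ N (α t) (α' t) = f t := by
  set g : F → F →L[ℝ] F := fun x => Ring.inverse (N x) with hg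
  have hg1 : ContDiffAt ℝ 1 g 0 := by
    have h1 : ContDiffAt ℝ 1 Ring.inverse (N 0) := by
      rw [hN0]; exact contDiffAt_ringInverse ℝ (1 : (F →L[ℝ] F)ˣ)
    exact h1.comp 0 hN.contDiffAt
  obtain ⟨K, s, hs, hK⟩ := hg1.exists_lipschitzOnWith
  have hunit : ∀ᶠ x in 𝓝 (0 : F), IsUnit (N x) := by
    have : ∀ᶠ y in 𝓝 (N 0), IsUnit y := by
      rw [hN0]; exact Units.nhds (1 : (F →L[ℝ] F)ˣ)
    exact hN.continuous.continuousAt.eventually this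
  obtain ⟨a, ha, hball⟩ := Metric.nhds_basis_closedBall.mem_iff.1 hs
  lift a to ℝ≥0 using ha.le
  obtain ⟨δ, hδ, hcont⟩ := Metric.eventually_nhds_iff.1
    (hf.and (hf.self_of_nhds.eventually (Metric.ball_mem_nhds (f t₀) one_pos)))
  -- `C` bounds `f` near `t₀`, `B` bounds `N⁻¹` on the ball of radius `a`, and `L = B C` bounds the
  -- speed; `L ε ≤ a` keeps the solution in that ball.
  set C : ℝ≥0 := ‖f t₀‖₊ + 1 with hC
  set B : ℝ≥0 := ‖g 0‖₊ + K * a with hB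
  set L : ℝ≥0 := B * C with hL
  obtain ⟨ε, hε, hεδ, hεL⟩ : ∃ ε > 0, ε < δ ∧ L * ε ≤ a := by
    refine ⟨min (δ / 2) (a / (L + 1)), by positivity, ?_, ?_⟩
    · exact (min_le_left _ _).trans_lt (by linarith)
    · calc (L : ℝ) * min (δ / 2) (a / (L + 1)) ≤ L * (a / (L + 1)) := by
            gcongr; exact min_le_right _ _
        _ = a * (L / (L + 1)) := by ring
        _ ≤ a * 1 := by
            gcongr
            rw [div_le_one (by positivity)]; linarith
        _ = a := mul_one _
  have hin : ∀ t ∈ Icc (t₀ - ε) (t₀ + ε), dist t t₀ < δ := by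
    intro t ht
    rw [Real.dist_eq, abs_lt]
    constructor <;> linarith [ht.1, ht.2]
  have hnorm : ∀ t ∈ Icc (t₀ - ε) (t₀ + ε), ‖f t‖ ≤ C := by
    intro t ht
    have := (hcont (hin t ht)).2
    rw [dist_eq_norm] at this
    have h2 := norm_le_norm_add_norm_sub' (f t) (f t₀)
    rw [hC]; push_cast
    linarith
  have hgB : ∀ x ∈ Metric.closedBall (0 : F) a, ‖g x‖ ≤ B := by
    intro x hx
    have h1 := hK.dist_le_mul x (hball hx) 0 (mem_of_mem_nhds hs)
    have h2 : dist x 0 ≤ a := hx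
    have h3 := norm_le_norm_add_norm_sub' (g x) (g 0)
    rw [dist_eq_norm] at h1
    rw [hB]; push_cast
    have : (K : ℝ) * dist x 0 ≤ K * a := by gcongr
    linarith
  have hPL : IsPicardLindelof (fun t x => g x (f t))
      (⟨t₀, by constructor <;> linarith⟩ : Icc (t₀ - ε) (t₀ + ε)) (0 : F) a 0 L (K * C) := by
    constructor
    · intro t ht
      refine LipschitzOnWith.of_dist_le_mul fun x hx y hy => ?_
      rw [dist_eq_norm, ← sub_apply]
      have h1 := hK.dist_le_mul x (hball hx) y (hball hy)
      rw [dist_eq_norm (g x)] at h1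
      calc ‖(g x - g y) (f t)‖ ≤ ‖g x - g y‖ * ‖f t‖ := ContinuousLinearMap.le_opNorm _ _
        _ ≤ (K * dist x y) * C := by
          gcongr
          exact hnorm t ht
        _ = _ := by push_cast; ring
    · intro x _ t ht
      exact ((g x).continuous.continuousAt.comp (hcont (hin t ht)).1).continuousWithinAt
    · intro t ht x hx
      calc ‖g x (f t)‖ ≤ ‖g x‖ * ‖f t‖ := ContinuousLinearMap.le_opNorm _ _
        _ ≤ B * C := by
          gcongr
          · exact hgB x hx
          · exact hnorm t ht
        _ = L := by rw [hL]; push_cast; ring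
    · simpa using hεL
  obtain ⟨α, hα0, hα⟩ := hPL.exists_eq_forall_mem_Icc_hasDerivWithinAt₀
  have hα0' : α t₀ = 0 := hα0
  have hI : ∀ᶠ t in 𝓝 t₀, t ∈ Ioo (t₀ - ε) (t₀ + ε) :=
    Ioo_mem_nhds (by linarith) (by linarith)
  have hderiv : ∀ t ∈ Ioo (t₀ - ε) (t₀ + ε), HasDerivAt α (g (α t) (f t)) t := fun t ht =>
    (hα t (Ioo_subset_Icc_self ht)).hasDerivAt (Icc_mem_nhds ht.1 ht.2)
  have hαc : ContinuousAt α t₀ := (hderiv t₀ hI.self_of_nhds).continuousAt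
  refine ⟨α, fun t => g (α t) (f t), ?_⟩
  filter_upwards [hI, hαc.eventually (hα0' ▸ hunit)] with t ht hu
  refine ⟨hderiv t ht, ?_⟩
  rw [hg, ← mul_apply_eq_comp, Ring.mul_inverse_cancel _ hu]
  rfl

/-- Local existence of curves tangent to a subalgebra with prescribed logarithmic derivative. -/
theorem exists_local_curve {ι : Type*} [Fintype ι] {e : ι → E} (hli : LinearIndependent ℝ e)
    (hlie : ∀ x ∈ Submodule.span ℝ (range e), ∀ y ∈ Submodule.span ℝ (range e),
      lieBr G x y ∈ Submodule.span ℝ (range e)) {u : ℝ → E} {t₀ : ℝ}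
    (hu : ∀ᶠ t in 𝓝 t₀, ContinuousAt u t ∧ u t ∈ Submodule.span ℝ (range e)) :
    ∃ c : ℝ → G, (∀ t, c t ∈ expClosure G e) ∧ ∀ᶠ t in 𝓝 t₀, HasLogDeriv c (u t) t := by
  classical
  obtain ⟨M, F, hM, hM0, hMh, hF, hd⟩ := exists_second_kind_coordinates (G := G) e
    (fun i => Submodule.subset_span (mem_range_self i)) hlie Finset.univ
  have hM0' : ∀ v, M 0 v = ∑ i, v i • e i := by
    intro v; rw [hM0]; simp
  have hker : LinearMap.ker (M 0 : (ι → ℝ) →ₗ[ℝ] E) = ⊥ := by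
    rw [LinearMap.ker_eq_bot']
    intro v hv
    have : ∑ i, v i • e i = 0 := by rw [← hM0']; exact hv
    ext i
    exact Fintype.linearIndependent_iff.1 hli v this i
  -- Composing with a left inverse of `M 0` turns the equation into one on `ι → ℝ` whose operator is
  -- the identity at `0`. Nothing is lost, since this left inverse is injective on the span, where
  -- both sides lie.
  obtain ⟨π, hπ⟩ := LinearMap.exists_leftInverse_of_injective _ hker
  set p : E →L[ℝ] (ι → ℝ) := LinearMap.toContinuousLinearMap π with hp
  have hpM : ∀ v, p (M 0 v) = v := fun v => LinearMap.congr_fun hπ v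
  have hrange : ∀ x ∈ Submodule.span ℝ (range e), M 0 (p x) = x := by
    intro x hx
    obtain ⟨v, rfl⟩ := (Submodule.mem_span_range_iff_exists_fun ℝ).1 hx
    rw [← hM0', hpM]
  obtain ⟨α, α', hα⟩ := exists_local_ode (N := fun x => p.comp (M x))
    (contDiff_const.clm_comp hM) (by ext1 v; exact hpM v) (f := fun t => p (u t)) (t₀ := t₀)
    (hu.mono fun t ht => p.continuous.continuousAt.comp ht.1)
  refine ⟨fun t => F (α t), fun t => hF _, ?_⟩
  filter_upwards [hα, hu] with t ht hut
  have h1 : M (α t) (α' t) = u t := by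
    rw [← hrange _ (hMh (α t) (α' t)), ← hrange _ hut.2]
    exact congrArg _ ht.2
  rw [← h1]
  exact hd α (α' t) t ht.1

/-- A curve tangent to a subalgebra stays in a coset of the subgroup it generates. -/
theorem HasLogDeriv.inv_mul_mem {ι : Type*} [Fintype ι] {e : ι → E} (hli : LinearIndependent ℝ e)
    (hlie : ∀ x ∈ Submodule.span ℝ (range e), ∀ y ∈ Submodule.span ℝ (range e),
      lieBr G x y ∈ Submodule.span ℝ (range e)) {a : ℝ → G} {u : ℝ → E} {p q : ℝ}
    (ha : ∀ t ∈ Ioo p q, HasLogDeriv a (u t) t)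
    (hu : ∀ t ∈ Ioo p q, ContinuousAt u t ∧ u t ∈ Submodule.span ℝ (range e))
    {s t : ℝ} (hs : s ∈ Ioo p q) (ht : t ∈ Ioo p q) : (a s)⁻¹ * a t ∈ expClosure G e := by
  -- Lying in the same left coset is an equivalence relation on times, so on an interval it suffices
  -- to prove it locally. There the curve is a left translate of a curve inside the subgroup.
  refine isPreconnected_Ioo.induction₂ (fun s t => (a s)⁻¹ * a t ∈ expClosure G e) ?_ ?_ ?_ hs ht
  · intro x hx
    have hI : ∀ᶠ t in 𝓝 x, t ∈ Ioo p q := Ioo_mem_nhds hx.1 hx.2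
    obtain ⟨c, hc, hcd⟩ := exists_local_curve hli hlie (hI.mono hu)
    obtain ⟨ε, hε, hball⟩ := Metric.eventually_nhds_iff.1 (hI.and hcd)
    have hd : ∀ t ∈ Ioo (x - ε) (x + ε), dist t x < ε := by
      intro t ht
      rw [Real.dist_eq, abs_lt]; constructor <;> linarith [ht.1, ht.2]
    have hx' : x ∈ Ioo (x - ε) (x + ε) := ⟨by linarith, by linarith⟩
    refine nhdsWithin_le_nhds ?_
    filter_upwards [Ioo_mem_nhds hx'.1 hx'.2] with t ht
    have := HasLogDeriv.eq_translate (fun t ht => ha t (hball (hd t ht)).1)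
      (fun t ht => (hball (hd t ht)).2) hx' ht
    rw [this, mul_assoc, inv_mul_cancel_left]
    exact mul_mem (inv_mem (hc _)) (hc _)
  · intro x y z _ _ _ h1 h2
    simpa [mul_assoc] using mul_mem h1 h2
  · intro x y _ _ h
    simpa using inv_mem h

end LocalCurves

/-! ### A connected group is generated by one-parameter subgroups. -/

section Generation

open Filter Topology Set

variable {E : Type*} [NormedAddCommGroup E] [NormedSpace ℝ E] [CompleteSpace E]
  [FiniteDimensional ℝ E]
  {G : Type*} [TopologicalSpace G] [T2Space G] [ChartedSpace E G] [Group G]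
  [LieGroup 𝓘(ℝ, E) ∞ G]

theorem chartDeriv_injective {g : G} (hg : g ∈ (chartAt E (1 : G)).source) :
    Function.Injective (chartDeriv (E := E) g) := by
  have hg' : g ∈ (extChartAt 𝓘(ℝ, E) (1 : G)).source := by simpa using hg
  have h := mfderivWithin_extChartAt_symm_comp_mfderiv_extChartAt' (I := 𝓘(ℝ, E)) hg'
  intro x y hxy
  have h1 := DFunLike.congr_fun h x
  have h2 := DFunLike.congr_fun h y
  exact h1.symm.trans ((congrArg _ hxy).trans h2)

/-- Smooth curves read in the preferred chart have a continuous logarithmic derivative. -/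
theorem hasLogDeriv_chart_symm {p : ℝ → E} {p' : E} {t : ℝ} (hp : HasDerivAt p p' t)
    (hmem : p t ∈ (chartOne E G).target) {u : E}
    (hu : chartLeft E ((chartOne E G).symm (p t)) u = p') :
    HasLogDeriv (fun s => (chartOne E G).symm (p s)) u t := by
  have hs : MDifferentiableAt 𝓘(ℝ, E) 𝓘(ℝ, E) (chartOne E G).symm (p t) :=
    ((contMDiffOn_extChartAt_symm (n := ∞) (1 : G)).contMDiffAt
      ((isOpen_extChartAt_target (1 : G)).mem_nhds hmem)).mdifferentiableAt (by simp)
  have hd := HasMFDerivAt.comp t hs.hasMFDerivAt hp.hasFDerivAt.hasMFDerivAt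
  refine HasVelocity.of_hasMFDerivAt hd ?_
  set S : E →L[ℝ] E := mfderiv 𝓘(ℝ, E) 𝓘(ℝ, E) (chartOne E G).symm (p t) with hS
  change S ((ContinuousLinearMap.toSpanSingleton ℝ p' : ℝ →L[ℝ] E) (1 : ℝ)) = _
  rw [ContinuousLinearMap.toSpanSingleton_apply, one_smul]
  have hsrc : (chartOne E G).symm (p t) ∈ (chartAt E (1 : G)).source := by
    simpa using (chartOne E G).map_target hmem
  refine chartDeriv_injective hsrc ?_
  have h1 : chartDeriv ((chartOne E G).symm (p t)) (S p') = p' := by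
    have h := mfderiv_extChartAt_comp_mfderivWithin_extChartAt_symm (I := 𝓘(ℝ, E)) (x := (1 : G))
      hmem
    rw [ModelWithCorners.range_eq_univ, mfderivWithin_univ] at h
    exact DFunLike.congr_fun h p'
  rw [h1]
  exact hu.symm

variable (E G) in
/-- The derivative of left translations in the preferred chart. -/
def chartFrame (p : E) : E →L[ℝ] E :=
  (fderiv ℝ (chartMul E G) (p, chartOne E G 1)).comp (ContinuousLinearMap.inr ℝ E E)

theorem chartFrame_one : chartFrame E G (chartOne E G 1) = 1 := by
  ext w
  have := (fderiv_chartMul_eq (E := E) (G := G)).self_of_nhds w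
  rw [chartOne_symm_one, chartLeft, leftDeriv_one] at this
  refine Eq.trans this ?_
  exact DFunLike.congr_fun (mfderiv_extChartAt_self (I := 𝓘(ℝ, E)) (x := (1 : G))) w

/-- As a partial derivative of a `C²` map the frame is continuous near the centre of the chart;
since it equals `1` at the centre, it stays invertible nearby. -/
theorem eventually_chartFrame :
    ∀ᶠ p in 𝓝 (chartOne E G 1), p ∈ (chartOne E G).target ∧ IsUnit (chartFrame E G p) ∧
      ContinuousAt (chartFrame E G) p ∧
      ∀ w, chartLeft E ((chartOne E G).symm p) w = chartFrame E G p w := by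
  have hc : Tendsto (fun p : E => (p, chartOne E G 1)) (𝓝 (chartOne E G 1))
      (𝓝 (chartOne E G 1, chartOne E G 1)) :=
    (Continuous.prodMk_left (chartOne E G 1)).tendsto _
  have hcont : ∀ᶠ p in 𝓝 (chartOne E G 1), ContinuousAt (chartFrame E G) p := by
    have h := (contDiffAt_chartMul (E := E) (G := G)).eventually (by simp)
    filter_upwards [hc.eventually h] with p hp
    have h1 : ContinuousAt (fderiv ℝ (chartMul E G)) (p, chartOne E G 1) :=
      (hp.fderiv_right (m := 0) (by norm_num)).continuousAt
    have h2 : ContinuousAt (fun p : E => fderiv ℝ (chartMul E G) (p, chartOne E G 1)) p :=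
      ContinuousAt.comp (f := fun p : E => (p, chartOne E G 1)) h1
        (Continuous.prodMk_left (chartOne E G 1)).continuousAt
    exact h2.clm_comp continuousAt_const
  have hunit : ∀ᶠ p in 𝓝 (chartOne E G 1), IsUnit (chartFrame E G p) := by
    have : ∀ᶠ y in 𝓝 (chartFrame E G (chartOne E G 1)), IsUnit y := by
      rw [chartFrame_one]; exact Units.nhds (1 : (E →L[ℝ] E)ˣ)
    exact hcont.self_of_nhds.eventually this
  filter_upwards [eventually_symm_mem_source (E := E) (G := G), hunit, hcont,
    fderiv_chartMul_eq (E := E) (G := G)] with p h1 h2 h3 h4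
  exact ⟨h1.1, h2, h3, fun w => (h4 w).symm⟩

/-- A connected Lie group is generated by the one-parameter subgroups of a basis. -/
theorem expClosure_basis_eq_top [ConnectedSpace G] {ι : Type*} [Fintype ι]
    (b : Module.Basis ι ℝ E) : expClosure G b = ⊤ := by
  have htop : IsTopologicalGroup G := topologicalGroup_of_lieGroup 𝓘(ℝ, E) ∞
  have hspan : ∀ x : E, x ∈ Submodule.span ℝ (range b) := fun x => by
    rw [b.span_eq]; trivial
  obtain ⟨R, hR, hball⟩ := Metric.eventually_nhds_iff.1 (eventually_chartFrame (E := E) (G := G))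
  -- A point `g` near `1` is joined to `1` by a segment in the chart. Its logarithmic derivative
  -- lies trivially in the span of the basis, so the segment cannot leave the subgroup.
  have hnhds : (expClosure G b : Set G) ∈ 𝓝 (1 : G) := by
    have hc : ContinuousAt (chartOne E G) 1 := continuousAt_extChartAt 1
    filter_upwards [extChartAt_source_mem_nhds (I := 𝓘(ℝ, E)) (1 : G),
      hc.eventually (Metric.ball_mem_nhds _ (half_pos hR))] with g hg hgR
    set e₀ := chartOne E G 1 with he₀
    set v := chartOne E G g - e₀ with hv
    have hvR : ‖v‖ < R / 2 := by
      have : dist (chartOne E G g) e₀ < R / 2 := hgR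
      rwa [dist_eq_norm] at this
    set p : ℝ → E := fun t => e₀ + t • v with hp
    -- The segment is prolonged to make `0` and `1` interior times, hence the bound `R / 2` on its
    -- direction.
    have hpR : ∀ t ∈ Ioo (-2 : ℝ) 2, dist (p t) e₀ < R := by
      intro t ht
      have h1 : |t| ≤ 2 := (abs_lt.2 ht).le
      rw [hp, dist_eq_norm, add_sub_cancel_left, norm_smul, Real.norm_eq_abs]
      calc |t| * ‖v‖ ≤ 2 * ‖v‖ := by gcongr
        _ < R := by linarith
    have hpd : ∀ t, HasDerivAt p v t := fun t => by
      have := ((hasDerivAt_id t).smul_const v).const_add e₀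
      rwa [one_smul] at this
    have key := HasLogDeriv.inv_mul_mem (G := G) b.linearIndependent
      (fun x _ y _ => hspan _) (a := fun t => (chartOne E G).symm (p t))
      (u := fun t => Ring.inverse (chartFrame E G (p t)) v) (p := -2) (q := 2)
      (fun t ht => by
        obtain ⟨h1, h2, -, h4⟩ := hball (hpR t ht)
        refine hasLogDeriv_chart_symm (hpd t) h1 ?_
        rw [h4, ← mul_apply_eq_comp, Ring.mul_inverse_cancel _ h2]
        rfl)
      (fun t ht => by
        obtain ⟨-, ⟨U, hU⟩, h3, -⟩ := hball (hpR t ht)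
        refine ⟨?_, hspan _⟩
        have h5 : ContinuousAt Ring.inverse (chartFrame E G (p t)) := by
          rw [← hU]; exact NormedRing.inverse_continuousAt U
        have h6 : ContinuousAt (fun t => chartFrame E G (p t)) t :=
          ContinuousAt.comp (f := p) h3 (hpd t).continuousAt
        have h7 : ContinuousAt (fun t => Ring.inverse (chartFrame E G (p t))) t :=
          ContinuousAt.comp (f := fun t => chartFrame E G (p t)) h5 h6
        exact h7.clm_apply continuousAt_const)
      (s := 0) (t := 1) (by constructor <;> norm_num) (by constructor <;> norm_num)
    have hp0 : p 0 = e₀ := by simp [hp]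
    have hp1 : p 1 = chartOne E G g := by simp [hp, hv]
    simp only [hp0, hp1] at key
    rw [he₀, chartOne_symm_one, (chartOne E G).left_inv hg] at key
    simpa using key
  have hopen := Subgroup.isOpen_of_mem_nhds _ hnhds
  have hclopen : IsClopen (expClosure G b : Set G) := ⟨Subgroup.isClosed_of_isOpen _ hopen, hopen⟩
  have := hclopen.eq_univ ⟨1, one_mem _⟩
  exact SetLike.coe_injective (by simpa using this)

end Generation

/-! ### Descent of the spectral decomposition from the complexification to the real space. -/

section Spectral

variable {L : Type*} [AddCommGroup L] [Module ℝ L]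

variable (L) in
/-- The real part `ℂ ⊗ L → L`. -/
def tensorRe : ℂ ⊗[ℝ] L →ₗ[ℝ] L :=
  (TensorProduct.lid ℝ L).toLinearMap ∘ₗ LinearMap.rTensor L Complex.reLm

variable (L) in
/-- Complex conjugation on `ℂ ⊗ L`. -/
def tensorConj : ℂ ⊗[ℝ] L →ₗ[ℝ] ℂ ⊗[ℝ] L :=
  LinearMap.rTensor L Complex.conjAe.toLinearMap

theorem tensorRe_one_tmul (x : L) : tensorRe L (1 ⊗ₜ x) = x := by simp [tensorRe]

theorem one_tmul_tensorRe (w : ℂ ⊗[ℝ] L) :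
    (1 : ℂ) ⊗ₜ[ℝ] tensorRe L w = (2⁻¹ : ℂ) • (w + tensorConj L w) := by
  induction w with
  | zero => simp
  | add x y hx hy => rw [map_add, TensorProduct.tmul_add, hx, hy, map_add, ← smul_add]; congr 1; abel
  | tmul z a =>
    simp only [tensorRe, tensorConj, LinearMap.comp_apply, LinearMap.rTensor_tmul,
      LinearEquiv.coe_coe, TensorProduct.lid_tmul, TensorProduct.tmul_smul]
    rw [← TensorProduct.add_tmul, TensorProduct.smul_tmul', TensorProduct.smul_tmul']
    congr 1
    apply Complex.ext
    · simp; ring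
    · simp

theorem eq_tensorRe_sub (w : ℂ ⊗[ℝ] L) :
    w = (1 : ℂ) ⊗ₜ[ℝ] tensorRe L w - Complex.I ⊗ₜ[ℝ] tensorRe L (Complex.I • w) := by
  induction w with
  | zero => simp
  | add x y hx hy =>
    rw [smul_add, map_add, map_add, TensorProduct.tmul_add, TensorProduct.tmul_add]
    nth_rewrite 1 [hx, hy]
    abel
  | tmul z a =>
    simp only [tensorRe, LinearMap.comp_apply, LinearMap.rTensor_tmul, TensorProduct.smul_tmul',
      LinearEquiv.coe_coe, TensorProduct.lid_tmul, TensorProduct.tmul_smul]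
    rw [← TensorProduct.sub_tmul]
    congr 1
    apply Complex.ext
    · simp
    · simp

theorem tensorRe_baseChange (D : L →ₗ[ℝ] L) (w : ℂ ⊗[ℝ] L) :
    tensorRe L (LinearMap.baseChange ℂ D w) = D (tensorRe L w) := by
  induction w with
  | zero => simp
  | add x y hx hy => simp [hx, hy]
  | tmul z a => simp [tensorRe]

theorem tensorConj_baseChange_sub (D : L →ₗ[ℝ] L) (α : ℂ) (w : ℂ ⊗[ℝ] L) :
    (LinearMap.baseChange ℂ D - (starRingEnd ℂ α) • (1 : Module.End ℂ (ℂ ⊗[ℝ] L)))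
      (tensorConj L w) =
    tensorConj L ((LinearMap.baseChange ℂ D - α • (1 : Module.End ℂ (ℂ ⊗[ℝ] L))) w) := by
  induction w with
  | zero => simp
  | add x y hx hy => simp only [map_add, hx, hy]
  | tmul z a => simp [tensorConj, TensorProduct.smul_tmul']

theorem tensorConj_mem {D : L →ₗ[ℝ] L} {α : ℂ} {w : ℂ ⊗[ℝ] L}
    (hw : w ∈ Module.End.maxGenEigenspace (LinearMap.baseChange ℂ D) α) :
    tensorConj L w ∈ Module.End.maxGenEigenspace (LinearMap.baseChange ℂ D) (starRingEnd ℂ α) := by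
  rw [Module.End.mem_maxGenEigenspace] at hw ⊢
  obtain ⟨k, hk⟩ := hw
  refine ⟨k, ?_⟩
  have : ∀ (k : ℕ) (w : ℂ ⊗[ℝ] L),
      ((LinearMap.baseChange ℂ D - (starRingEnd ℂ α) • (1 : Module.End ℂ (ℂ ⊗[ℝ] L))) ^ k)
        (tensorConj L w) =
      tensorConj L (((LinearMap.baseChange ℂ D - α • (1 : Module.End ℂ (ℂ ⊗[ℝ] L))) ^ k) w) := by
    intro k
    induction k with
    | zero => simp
    | succ k ih =>
      intro w
      rw [pow_succ, pow_succ, Module.End.mul_apply, Module.End.mul_apply,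
        tensorConj_baseChange_sub, ih]
  rw [this, hk, map_zero]

/-- The sum of the generalized eigenspaces with real part in `s`, in the complexification. -/
def complexPart (D : L →ₗ[ℝ] L) (s : Set ℝ) : Submodule ℂ (ℂ ⊗[ℝ] L) :=
  ⨆ α : {z : ℂ // z.re ∈ s}, Module.End.maxGenEigenspace (LinearMap.baseChange ℂ D) (α : ℂ)

theorem mem_spectralPart {D : L →ₗ[ℝ] L} {s : Set ℝ} {x : L} :
    x ∈ spectralPart D s ↔ (1 : ℂ) ⊗ₜ[ℝ] x ∈ complexPart D s := Iff.rfl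

theorem mem_complexPart {D : L →ₗ[ℝ] L} {s : Set ℝ} {α : ℂ} (hα : α.re ∈ s) {w : ℂ ⊗[ℝ] L}
    (hw : w ∈ Module.End.maxGenEigenspace (LinearMap.baseChange ℂ D) α) :
    w ∈ complexPart D s :=
  Submodule.mem_iSup_of_mem (p := fun α : {z : ℂ // z.re ∈ s} =>
    Module.End.maxGenEigenspace (LinearMap.baseChange ℂ D) (α : ℂ)) ⟨α, hα⟩ hw

theorem complexPart_mono {D : L →ₗ[ℝ] L} {s t : Set ℝ} (h : s ⊆ t) :
    complexPart D s ≤ complexPart D t :=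
  iSup_le fun α _ hw => mem_complexPart (h α.2) hw

theorem spectralPart_mono {D : L →ₗ[ℝ] L} {s t : Set ℝ} (h : s ⊆ t) :
    spectralPart D s ≤ spectralPart D t := fun _ hx =>
  mem_spectralPart.2 (complexPart_mono h (mem_spectralPart.1 hx))

/-- Conjugation exchanges the generalized eigenspaces of `α` and its conjugate, which have the same
real part, and the real part of `w` is half the sum of `w` and its conjugate. -/
theorem tensorRe_mem_spectralPart {D : L →ₗ[ℝ] L} {α : ℂ} {w : ℂ ⊗[ℝ] L}
    (hw : w ∈ Module.End.maxGenEigenspace (LinearMap.baseChange ℂ D) α) :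
    tensorRe L w ∈ spectralPart D {α.re} := by
  rw [mem_spectralPart, one_tmul_tensorRe]
  have h1 : w ∈ complexPart D {α.re} := mem_complexPart (Set.mem_singleton _) hw
  have h2 : tensorConj L w ∈ complexPart D {α.re} :=
    mem_complexPart (by simp) (tensorConj_mem hw)
  exact (complexPart D {α.re}).smul_mem _ ((complexPart D {α.re}).add_mem h1 h2)

theorem tensorRe_mem_iSup {D : L →ₗ[ℝ] L} {s : Set ℝ} {w : ℂ ⊗[ℝ] L}
    (hw : w ∈ complexPart D s) : tensorRe L w ∈ ⨆ r ∈ s, spectralPart D {r} := by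
  induction hw using Submodule.iSup_induction' with
  | mem α x hx =>
    have h : spectralPart D {(α : ℂ).re} ≤ ⨆ r ∈ s, spectralPart D {r} :=
      le_biSup (fun r : ℝ => spectralPart D {r}) α.2
    exact h (tensorRe_mem_spectralPart hx)
  | zero => simp
  | add x y _ _ hx hy => rw [map_add]; exact Submodule.add_mem _ hx hy

/-- A real vector is its own real part, so taking real parts in its complex decomposition yields a
real one. -/
theorem spectralPart_eq_iSup (D : L →ₗ[ℝ] L) (s : Set ℝ) :
    spectralPart D s = ⨆ r ∈ s, spectralPart D {r} := by
  apply le_antisymm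
  · intro x hx
    rw [← tensorRe_one_tmul x]
    exact tensorRe_mem_iSup hx
  · exact iSup₂_le fun r hr => spectralPart_mono (by simpa using hr)

theorem spectralPart_univ [FiniteDimensional ℝ L] (D : L →ₗ[ℝ] L) :
    spectralPart D Set.univ = ⊤ := by
  rw [eq_top_iff]
  intro x _
  rw [mem_spectralPart]
  have h := Module.End.iSup_maxGenEigenspace_eq_top (LinearMap.baseChange ℂ D)
  have : complexPart D Set.univ = ⊤ := by
    rw [eq_top_iff, ← h]
    exact iSup_le fun α _ hw => mem_complexPart (Set.mem_univ _) hw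
  rw [this]; trivial

theorem iSupIndep_spectralPart (D : L →ₗ[ℝ] L) :
    iSupIndep fun r : ℝ => spectralPart D {r} := by
  intro r
  rw [Submodule.disjoint_def]
  intro x hx hx'
  have h1 : (1 : ℂ) ⊗ₜ[ℝ] x ∈ complexPart D {r} := hx
  have h2 : (1 : ℂ) ⊗ₜ[ℝ] x ∈ complexPart D {r}ᶜ := by
    have : (⨆ j, ⨆ (_ : j ≠ r), spectralPart D {j}) ≤ spectralPart D {r}ᶜ :=
      iSup₂_le fun j hj => spectralPart_mono (by simpa using hj.symm)
    exact this hx'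
  have hind := (Module.End.independent_maxGenEigenspace (LinearMap.baseChange ℂ D)).disjoint_biSup_biSup
    (s := {z : ℂ | z.re ∈ ({r} : Set ℝ)}) (t := {z : ℂ | z.re ∈ ({r}ᶜ : Set ℝ)})
    (Set.disjoint_left.2 fun z hz hz' => hz' hz)
  have e : ∀ s : Set ℝ, complexPart D s = ⨆ z ∈ {z : ℂ | z.re ∈ s},
      Module.End.maxGenEigenspace (LinearMap.baseChange ℂ D) z := fun s => iSup_subtype
  rw [e] at h1 h2
  have h0 := Submodule.disjoint_def.1 hind _ h1 h2
  rw [← tensorRe_one_tmul x, h0, map_zero]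

/-- A basis adapted to the decomposition according to the real parts of the eigenvalues. -/
theorem exists_spectral_basis [FiniteDimensional ℝ L] (D : L →ₗ[ℝ] L) :
    ∃ (n : ℕ) (b : Module.Basis (Fin n) ℝ L) (ρ : Fin n → ℝ),
      ∀ s, spectralPart D s = Submodule.span ℝ (b '' {i | ρ i ∈ s}) := by
  classical
  have hint : DirectSum.IsInternal fun r : ℝ => spectralPart D {r} :=
    DirectSum.isInternal_submodule_of_iSupIndep_of_iSup_eq_top (iSupIndep_spectralPart D) (by
      have := spectralPart_eq_iSup D Set.univ
      rw [spectralPart_univ] at this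
      simpa using this.symm)
  let v := fun r : ℝ => Module.finBasis ℝ (spectralPart D {r})
  let b₀ := hint.collectedBasis v
  have : Finite (Σ r : ℝ, Fin (Module.finrank ℝ (spectralPart D {r}))) := Module.Finite.finite_basis b₀
  let e := Finite.equivFin (Σ r : ℝ, Fin (Module.finrank ℝ (spectralPart D {r})))
  refine ⟨_, b₀.reindex e, fun i => (e.symm i).1, fun s => ?_⟩
  have hmem : ∀ i, (b₀.reindex e) i ∈ spectralPart D {(e.symm i).1} := fun i => by
    rw [Module.Basis.reindex_apply]; exact hint.collectedBasis_mem v _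
  apply le_antisymm
  · rw [spectralPart_eq_iSup]
    refine iSup₂_le fun r hr x hx => ?_
    have h1 : x = ∑ k, (v r).repr ⟨x, hx⟩ k • (v r k : L) := by
      have := congrArg (Submodule.subtype _) ((v r).sum_repr ⟨x, hx⟩)
      rw [map_sum] at this
      exact this.symm
    rw [h1]
    refine Submodule.sum_mem _ fun k _ => Submodule.smul_mem _ _ (Submodule.subset_span ?_)
    refine ⟨e ⟨r, k⟩, by simpa using hr, ?_⟩
    rw [Module.Basis.reindex_apply, Equiv.symm_apply_apply]
    simp [b₀]
  · rw [Submodule.span_le]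
    rintro _ ⟨i, hi, rfl⟩
    exact spectralPart_mono (by simpa using hi) (hmem i)

end Spectral

/-! ### Weights add under brackets; skew maps have imaginary spectrum. -/

section Bracket

variable {L : Type*} [LieRing L] [LieAlgebra ℝ L]

variable (L) in
/-- The Lie bracket on the complexification, as a bilinear map. -/
def complexBracket : ℂ ⊗[ℝ] L →ₗ[ℂ] ℂ ⊗[ℝ] L →ₗ[ℂ] ℂ ⊗[ℝ] L :=
  LinearMap.BilinMap.baseChange ℂ (LieModule.toEnd ℝ L L : L →ₗ[ℝ] L →ₗ[ℝ] L)

theorem complexBracket_tmul (z w : ℂ) (a b : L) :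
    complexBracket L (z ⊗ₜ a) (w ⊗ₜ b) = (z * w) ⊗ₜ ⁅a, b⁆ := by
  simp [complexBracket]

theorem baseChange_complexBracket (D : LieDerivation ℝ L L) (x y : ℂ ⊗[ℝ] L) :
    LinearMap.baseChange ℂ D.toLinearMap (complexBracket L x y) =
      complexBracket L (LinearMap.baseChange ℂ D.toLinearMap x) y +
        complexBracket L x (LinearMap.baseChange ℂ D.toLinearMap y) := by
  induction x with
  | zero => simp
  | add x x' hx hx' => simp only [map_add, LinearMap.add_apply, hx, hx']; abel
  | tmul z a =>
    induction y with
    | zero => simp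
    | add y y' hy hy' => simp only [map_add, hy, hy']; abel
    | tmul w b =>
      simp only [complexBracket_tmul, LinearMap.baseChange_tmul]
      rw [← TensorProduct.tmul_add]
      congr 1
      have := D.apply_lie_eq_add a b
      rw [add_comm] at this
      exact this

theorem complexBracket_mem_maxGenEigenspace_add (D : LieDerivation ℝ L L) {α β : ℂ}
    {x y : ℂ ⊗[ℝ] L}
    (hx : x ∈ Module.End.maxGenEigenspace (LinearMap.baseChange ℂ D.toLinearMap) α)
    (hy : y ∈ Module.End.maxGenEigenspace (LinearMap.baseChange ℂ D.toLinearMap) β) :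
    complexBracket L x y ∈
      Module.End.maxGenEigenspace (LinearMap.baseChange ℂ D.toLinearMap) (α + β) := by
  rw [Module.End.mem_maxGenEigenspace] at hx hy ⊢
  obtain ⟨k, hk⟩ := hx
  obtain ⟨l, hl⟩ := hy
  set T := LinearMap.baseChange ℂ D.toLinearMap with hT
  -- By the Leibniz rule `T - (α + β)` applied to `[x, y]` gives `[(T - α) x, y] + [x, (T - β) y]`;
  -- each term lowers `k` or `l` by one, so `k + l` applications suffice.
  have key : ∀ (n k l : ℕ) (x y : ℂ ⊗[ℝ] L), k + l ≤ n →
      ((T - α • (1 : Module.End ℂ (ℂ ⊗[ℝ] L))) ^ k) x = 0 →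
      ((T - β • (1 : Module.End ℂ (ℂ ⊗[ℝ] L))) ^ l) y = 0 →
      ((T - (α + β) • (1 : Module.End ℂ (ℂ ⊗[ℝ] L))) ^ n) (complexBracket L x y) = 0 := by
    intro n
    induction n with
    | zero =>
      intro k l x y hkl hx hy
      obtain rfl : k = 0 := by omega
      have : x = 0 := by simpa using hx
      simp [this]
    | succ n ih =>
      intro k l x y hkl hx hy
      rcases k with _ | k
      · have : x = 0 := by simpa using hx
        simp [this]
      rcases l with _ | l
      · have : y = 0 := by simpa using hy
        simp [this]
      have h : (T - (α + β) • (1 : Module.End ℂ (ℂ ⊗[ℝ] L))) (complexBracket L x y) =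
          complexBracket L ((T - α • (1 : Module.End ℂ (ℂ ⊗[ℝ] L))) x) y +
          complexBracket L x ((T - β • (1 : Module.End ℂ (ℂ ⊗[ℝ] L))) y) := by
        simp only [LinearMap.sub_apply, LinearMap.add_apply, LinearMap.smul_apply,
          Module.End.one_apply, hT, baseChange_complexBracket, map_sub, map_smul, add_smul]
        abel
      rw [pow_succ, Module.End.mul_apply, h, map_add]
      rw [pow_succ, Module.End.mul_apply] at hx hy
      rw [ih k (l + 1) _ y (by omega) hx (by rw [pow_succ, Module.End.mul_apply]; exact hy),
        ih (k + 1) l x _ (by omega) (by rw [pow_succ, Module.End.mul_apply]; exact hx) hy, add_zero]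
  exact ⟨k + l, key _ k l x y le_rfl hk hl⟩

theorem complexBracket_mem_complexPart (D : LieDerivation ℝ L L) {r s : ℝ} {x y : ℂ ⊗[ℝ] L}
    (hx : x ∈ complexPart D.toLinearMap {r}) (hy : y ∈ complexPart D.toLinearMap {s}) :
    complexBracket L x y ∈ complexPart D.toLinearMap {r + s} := by
  induction hx using Submodule.iSup_induction' with
  | zero => rw [map_zero, LinearMap.zero_apply]; exact Submodule.zero_mem _
  | add x x' _ _ hx hx' =>
    rw [map_add, LinearMap.add_apply]; exact Submodule.add_mem _ hx hx'
  | mem α x hx =>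
    induction hy using Submodule.iSup_induction' with
    | zero => rw [map_zero]; exact Submodule.zero_mem _
    | add y y' _ _ hy hy' => rw [map_add]; exact Submodule.add_mem _ hy hy'
    | mem β y hy =>
      refine mem_complexPart ?_ (complexBracket_mem_maxGenEigenspace_add D hx hy)
      have h1 : α.1.re = r := α.2
      have h2 : β.1.re = s := β.2
      simp [h1, h2]

theorem lie_mem_spectralPart (D : LieDerivation ℝ L L) {r s : ℝ} {x y : L}
    (hx : x ∈ spectralPart D.toLinearMap {r}) (hy : y ∈ spectralPart D.toLinearMap {s}) :
    ⁅x, y⁆ ∈ spectralPart D.toLinearMap {r + s} := by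
  rw [mem_spectralPart] at *
  have := complexBracket_mem_complexPart D hx hy
  rwa [complexBracket_tmul, one_mul] at this

/-- An infinitesimal isometry of a positive definite form has a purely imaginary spectrum. -/
theorem spectralPart_zero_of_skew (D : L →ₗ[ℝ] L) [FiniteDimensional ℝ L]
    (Q : L →ₗ[ℝ] L →ₗ[ℝ] ℝ) (hsymm : ∀ x y, Q x y = Q y x) (hpos : ∀ x, x ≠ 0 → 0 < Q x x)
    (hskew : ∀ x, Q (D x) x = 0) : spectralPart D {0} = ⊤ := by
  have hnon : ∀ x, 0 ≤ Q x x := fun x => by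
    rcases eq_or_ne x 0 with rfl | h
    · simp
    · exact (hpos x h).le
  have hzero : ∀ x, Q x x = 0 → x = 0 := fun x h => by
    by_contra hx
    exact (hpos x hx).ne' h
  rw [eq_top_iff, ← spectralPart_univ D]
  intro x hx
  rw [mem_spectralPart] at hx ⊢
  refine (iSup_le fun α => ?_ : complexPart D Set.univ ≤ complexPart D {0}) hx
  by_cases hα : α.1.re = 0
  · exact fun w hw => mem_complexPart hα hw
  suffices h : Module.End.maxGenEigenspace (LinearMap.baseChange ℂ D) α.1 = ⊥ by
    rw [h]; exact bot_le
  by_contra hne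
  have hev : Module.End.HasEigenvalue (LinearMap.baseChange ℂ D) α.1 :=
    Module.End.HasUnifEigenvalue.lt zero_lt_one hne
  obtain ⟨w, hw⟩ := hev.exists_hasEigenvector
  have hw1 := hw.apply_eq_smul
  set a := tensorRe L w
  set c := tensorRe L (Complex.I • w)
  have hre : ∀ z : ℂ, tensorRe L (z • w) = z.re • a + z.im • c := by
    intro z
    conv_lhs => rw [← Complex.re_add_im z, add_smul, mul_smul]
    rw [map_add]
    have e : ∀ (r : ℝ) (w : ℂ ⊗[ℝ] L), tensorRe L ((r : ℂ) • w) = r • tensorRe L w := by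
      intro r w
      rw [← map_smul]
      congr 1
    rw [e, e]
  have ha : D a = α.1.re • a + α.1.im • c := by
    rw [← tensorRe_baseChange, hw1, hre]
  have hc : D c = α.1.re • c - α.1.im • a := by
    rw [← tensorRe_baseChange, map_smul, hw1, smul_smul, hre]
    simp
    abel
  have h1 := hskew a
  have h2 := hskew c
  rw [ha] at h1
  rw [hc] at h2
  simp only [map_add, map_sub, map_smul, LinearMap.add_apply, LinearMap.sub_apply,
    LinearMap.smul_apply, smul_eq_mul] at h1 h2
  rw [hsymm a c] at h2
  -- With `w = a - i c` the eigenvalue equation is a rotation-dilation of the pair `(a, c)`; in the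
  -- sum of the two skewness relations the `Im α` terms cancel by symmetry of `Q`.
  have h3 : α.1.re * (Q a a + Q c c) = 0 := by linear_combination h1 + h2
  have h4 : Q a a + Q c c = 0 := (mul_eq_zero.1 h3).resolve_left hα
  have ha0 : a = 0 := hzero a (by linarith [hnon a, hnon c])
  have hc0 : c = 0 := hzero c (by linarith [hnon a, hnon c])
  refine hw.2 ?_
  rw [eq_tensorRe_sub w]
  change (1 : ℂ) ⊗ₜ[ℝ] a - Complex.I ⊗ₜ[ℝ] c = 0
  rw [ha0, hc0]
  simp

end Bracket

/-! ### Traces relative to a positive definite form, and nilpotency from commutators. -/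

section Trace

variable {V : Type*} [AddCommGroup V] [Module ℝ V] [FiniteDimensional ℝ V]

/-- The trace in terms of an orthogonal basis of a positive definite form. -/
theorem exists_basis_trace_eq (Q : V →ₗ[ℝ] V →ₗ[ℝ] ℝ) (hsymm : ∀ x y, Q x y = Q y x)
    (hpos : ∀ x, x ≠ 0 → 0 < Q x x) :
    ∃ v : Module.Basis (Fin (Module.finrank ℝ V)) ℝ V, ∀ T : V →ₗ[ℝ] V,
      LinearMap.trace ℝ V T = ∑ i, (Q (v i) (v i))⁻¹ * Q (v i) (T (v i)) := by
  obtain ⟨v, hv⟩ := LinearMap.BilinForm.exists_orthogonal_basis (B := Q) ⟨fun x y => hsymm x y⟩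
  refine ⟨v, fun T => ?_⟩
  rw [LinearMap.trace_eq_matrix_trace ℝ v, Matrix.trace]
  refine Finset.sum_congr rfl fun i _ => ?_
  rw [Matrix.diag_apply, LinearMap.toMatrix_apply]
  have h : Q (v i) (T (v i)) = v.repr (T (v i)) i * Q (v i) (v i) := by
    conv_lhs => rw [← v.sum_repr (T (v i))]
    rw [map_sum, Finset.sum_eq_single i]
    · simp
    · intro j _ hj
      rw [map_smul, hv (Ne.symm hj), smul_zero]
    · simp
  rw [h]
  have := (hpos (v i) (v.ne_zero i)).ne'
  field_simp

theorem trace_eq_of_adjoint (Q : V →ₗ[ℝ] V →ₗ[ℝ] ℝ) (hsymm : ∀ x y, Q x y = Q y x)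
    (hpos : ∀ x, x ≠ 0 → 0 < Q x x) {T T' : V →ₗ[ℝ] V} (h : ∀ x y, Q (T x) y = Q x (T' y)) :
    LinearMap.trace ℝ V T = LinearMap.trace ℝ V T' := by
  obtain ⟨v, hv⟩ := exists_basis_trace_eq Q hsymm hpos
  rw [hv, hv]
  refine Finset.sum_congr rfl fun i _ => ?_
  rw [hsymm (v i) (T (v i)), h]

theorem skew_polarize {Q : V →ₗ[ℝ] V →ₗ[ℝ] ℝ} (hsymm : ∀ x y, Q x y = Q y x) {A : V →ₗ[ℝ] V}
    (h : ∀ x, Q (A x) x = 0) (x y : V) : Q (A x) y = - Q x (A y) := by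
  have h1 := h (x + y)
  simp only [map_add, LinearMap.add_apply, h, zero_add, add_zero] at h1
  rw [hsymm x (A y)]
  linarith

/-- For skew `A`, the trace of `A²` is minus a sum of positive multiples of `Q (A vᵢ) (A vᵢ)` over
an orthogonal basis, so every term vanishes. -/
theorem eq_zero_of_skew_of_trace_mul_self (Q : V →ₗ[ℝ] V →ₗ[ℝ] ℝ)
    (hsymm : ∀ x y, Q x y = Q y x) (hpos : ∀ x, x ≠ 0 → 0 < Q x x) {A : V →ₗ[ℝ] V}
    (h : ∀ x, Q (A x) x = 0) (htr : LinearMap.trace ℝ V (A ∘ₗ A) = 0) : A = 0 := by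
  obtain ⟨v, hv⟩ := exists_basis_trace_eq Q hsymm hpos
  rw [hv] at htr
  have hnon : ∀ x, 0 ≤ Q x x := fun x => by
    rcases eq_or_ne x 0 with rfl | h
    · simp
    · exact (hpos x h).le
  have hle : ∀ i ∈ Finset.univ, (Q (v i) (v i))⁻¹ * Q (v i) ((A ∘ₗ A) (v i)) ≤ 0 := by
    intro i _
    have h1 : Q (v i) ((A ∘ₗ A) (v i)) = - Q (A (v i)) (A (v i)) := by
      rw [skew_polarize hsymm h, neg_neg]; rfl
    rw [h1]
    have := hnon (A (v i))
    have := inv_nonneg.2 (hnon (v i))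
    nlinarith
  refine v.ext fun i => ?_
  have h0 := (Finset.sum_eq_zero_iff_of_nonpos hle).1 htr i (Finset.mem_univ i)
  have h1 : Q (v i) ((A ∘ₗ A) (v i)) = - Q (A (v i)) (A (v i)) := by
    rw [skew_polarize hsymm h, neg_neg]; rfl
  have h2 := (mul_eq_zero.1 h0).resolve_left (inv_ne_zero (hpos _ (v.ne_zero i)).ne')
  by_contra hne
  have := hpos _ hne
  linarith

/-- The powers `A ^ k`, if all nonzero, would be eigenvectors of the commutator with `S` for the
distinct eigenvalues `k r`, too many for a finite-dimensional space. -/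
theorem isNilpotent_of_commutator_eq_smul {S A : Module.End ℝ V} {r : ℝ} (hr : r ≠ 0)
    (h : S * A - A * S = r • A) : IsNilpotent A := by
  by_contra hA
  let T : Module.End ℝ (Module.End ℝ V) := LinearMap.mulLeft ℝ S - LinearMap.mulRight ℝ S
  have hT : ∀ k : ℕ, T (A ^ k) = (k * r) • A ^ k := by
    intro k
    induction k with
    | zero => simp [T]
    | succ k ih =>
      have h1 : T (A ^ (k + 1)) = T (A ^ k) * A + A ^ k * (S * A - A * S) := by
        simp only [T, LinearMap.sub_apply, LinearMap.mulLeft_apply, LinearMap.mulRight_apply,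
          pow_succ]
        noncomm_ring
      rw [h1, ih, h, pow_succ, smul_mul_assoc, mul_smul_comm, ← add_smul]
      congr 1
      push_cast
      ring
  have hinj : Function.Injective fun k : ℕ => (k * r : ℝ) := fun k l hkl => by
    exact_mod_cast mul_right_cancel₀ hr hkl
  refine Set.infinite_range_of_injective hinj
    ((Module.End.finite_hasEigenvalue T).subset ?_)
  rintro _ ⟨k, rfl⟩
  exact Module.End.hasEigenvalue_of_hasEigenvector
    ⟨Module.End.mem_eigenspace_iff.2 (hT k), fun h0 => hA ⟨k, h0⟩⟩

end Trace

/-! ### Diagonal maps and weight projections. -/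

section Diagonal

variable {V : Type*} [AddCommGroup V] [Module ℝ V] {ι : Type*} [Fintype ι]

/-- The part of `x` with weights in `s`. -/
def weightProj (b : Module.Basis ι ℝ V) (ρ : ι → ℝ) (s : Set ℝ) : V →ₗ[ℝ] V :=
  b.constr ℝ fun i => s.indicator (fun _ => b i) (ρ i)

/-- The endomorphism with the given eigenbasis and eigenvalues. -/
def weightMap (b : Module.Basis ι ℝ V) (ρ : ι → ℝ) : V →ₗ[ℝ] V :=
  b.constr ℝ fun i => ρ i • b i

variable (b : Module.Basis ι ℝ V) (ρ : ι → ℝ)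

theorem weightMap_basis (i : ι) : weightMap b ρ (b i) = ρ i • b i := b.constr_basis ℝ _ i

theorem weightProj_basis_of_mem {s : Set ℝ} {i : ι} (h : ρ i ∈ s) :
    weightProj b ρ s (b i) = b i := by
  rw [weightProj, Module.Basis.constr_basis, Set.indicator_of_mem h]

theorem weightProj_basis_of_notMem {s : Set ℝ} {i : ι} (h : ρ i ∉ s) :
    weightProj b ρ s (b i) = 0 := by
  rw [weightProj, Module.Basis.constr_basis, Set.indicator_of_notMem h]

theorem weightProj_mem_span (s : Set ℝ) (x : V) :
    weightProj b ρ s x ∈ Submodule.span ℝ (b '' {i | ρ i ∈ s}) := by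
  rw [weightProj, Module.Basis.constr_apply_fintype]
  refine Submodule.sum_mem _ fun i _ => Submodule.smul_mem _ _ ?_
  by_cases h : ρ i ∈ s
  · rw [Set.indicator_of_mem h]; exact Submodule.subset_span ⟨i, h, rfl⟩
  · rw [Set.indicator_of_notMem h]; exact Submodule.zero_mem _

theorem weightProj_add_compl (s : Set ℝ) (x : V) :
    weightProj b ρ s x + weightProj b ρ sᶜ x = x := by
  suffices weightProj b ρ s + weightProj b ρ sᶜ = LinearMap.id from DFunLike.congr_fun this x
  refine b.ext fun i => ?_
  by_cases h : ρ i ∈ s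
  · have h' : ρ i ∉ sᶜ := fun h' => h' h
    simp [weightProj_basis_of_mem b ρ h, weightProj_basis_of_notMem b ρ h']
  · have h' : ρ i ∈ sᶜ := h
    simp [weightProj_basis_of_notMem b ρ h, weightProj_basis_of_mem b ρ h']

theorem weightMap_weightProj_singleton (r : ℝ) (x : V) :
    weightMap b ρ (weightProj b ρ {r} x) = r • weightProj b ρ {r} x := by
  suffices weightMap b ρ ∘ₗ weightProj b ρ {r} = r • weightProj b ρ {r} from
    DFunLike.congr_fun this x
  refine b.ext fun i => ?_
  by_cases h : ρ i ∈ ({r} : Set ℝ)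
  · have h' : ρ i = r := h
    simp [weightProj_basis_of_mem b ρ h, weightMap_basis, h']
  · simp [weightProj_basis_of_notMem b ρ h]

theorem sum_weightProj_singleton (x : V) :
    ∑ r ∈ Finset.univ.image ρ, weightProj b ρ {r} x = x := by
  suffices ∑ r ∈ Finset.univ.image ρ, weightProj b ρ {r} = LinearMap.id by
    rw [← LinearMap.sum_apply, this]; rfl
  refine b.ext fun i => ?_
  rw [LinearMap.sum_apply, Finset.sum_eq_single (ρ i)]
  · rw [weightProj_basis_of_mem b ρ (Set.mem_singleton _)]; rfl
  · intro r _ hr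
    exact weightProj_basis_of_notMem b ρ fun h => hr h.symm
  · intro h
    exact absurd (Finset.mem_image_of_mem ρ (Finset.mem_univ i)) h

/-- A subspace stable under a diagonal map is stable under the weight projections. -/
theorem weightProj_mem {F : Submodule ℝ V} (hF : ∀ x ∈ F, weightMap b ρ x ∈ F) (s : Set ℝ)
    {x : V} (hx : x ∈ F) : weightProj b ρ s x ∈ F := by
  classical
  -- Interpolating the indicator of `s` at the weights exhibits the projection as a polynomial in
  -- the diagonal map.
  set p : Polynomial ℝ := Lagrange.interpolate (Finset.univ.image ρ) id (s.indicator 1)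
  have hp : Polynomial.aeval (weightMap b ρ) p = weightProj b ρ s := by
    refine b.ext fun i => ?_
    have hev : Module.End.HasEigenvector (weightMap b ρ) (ρ i) (b i) :=
      ⟨Module.End.mem_eigenspace_iff.2 (weightMap_basis b ρ i), b.ne_zero i⟩
    have hpi : p.eval (ρ i) = s.indicator 1 (ρ i) :=
      Lagrange.eval_interpolate_at_node (v := id) _ (Set.injOn_id _)
        (Finset.mem_image_of_mem ρ (Finset.mem_univ i))
    rw [Module.End.aeval_apply_of_hasEigenvector hev, hpi]
    by_cases h : ρ i ∈ s
    · simp [h, weightProj_basis_of_mem b ρ h]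
    · simp [h, weightProj_basis_of_notMem b ρ h]
  rw [← hp]
  induction p using Polynomial.induction_on' with
  | add p q hp hq => rw [map_add]; exact F.add_mem hp hq
  | monomial n a =>
    rw [Polynomial.aeval_monomial]
    refine F.smul_mem a ?_
    have : ∀ n : ℕ, ((weightMap b ρ) ^ n) x ∈ F := by
      intro n
      induction n with
      | zero => exact hx
      | succ n ih => rw [pow_succ']; exact hF _ ih
    exact this n

end Diagonal

/-! ### Engel's theorem with nilpotency checked on a spanning set. -/

section Engel

variable {R L M : Type*} [CommRing R] [LieRing L] [LieAlgebra R L] [IsNoetherian R L]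
  [AddCommGroup M] [Module R M] [LieRingModule L M] [LieModule R L M]

/-- If the derived algebra acts nilpotently, it is enough to check nilpotency on generators. -/
theorem lieModule_isNilpotent_of_span {Ω : Set L} (hΩ : Submodule.span R Ω = ⊤)
    (hnil : ∀ x ∈ Ω, IsNilpotent (LieModule.toEnd R L M x))
    (hder : LieModule.IsNilpotent (LieAlgebra.derivedSeries R L 1) M) :
    LieModule.IsNilpotent L M := by
  -- A maximal subalgebra that contains all brackets and acts nilpotently is taken. Containing the
  -- brackets makes it normalized by every element, so a missing element of `Ω` could be adjoined.
  let s := {K : LieSubalgebra R L | (∀ x y : L, ⁅x, y⁆ ∈ K) ∧ LieModule.IsNilpotent K M}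
  have hs : s.Nonempty := by
    refine ⟨(LieAlgebra.derivedSeries R L 1).toLieSubalgebra R L, fun x y => ?_, hder⟩
    exact LieSubmodule.lie_mem_lie (LieSubmodule.mem_top x) (LieSubmodule.mem_top y)
  obtain ⟨K, ⟨hK₁, hK₂⟩, hmax⟩ := (LieSubalgebra.wellFoundedGT_of_noetherian R L).wf.has_min s hs
  suffices hK : K = ⊤ by
    subst hK
    exact (LieModule.isNilpotent_of_top_iff (R := R)).1 hK₂
  by_contra hne
  obtain ⟨x, hxΩ, hxK⟩ : ∃ x ∈ Ω, x ∉ K := by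
    by_contra! h
    refine hne ((LieSubalgebra.toSubmodule_inj _ _).1 ?_)
    exact eq_top_iff.2 (hΩ ▸ Submodule.span_le.2 h)
  have hx₁ : x ∈ K.normalizer := (LieSubalgebra.mem_normalizer_iff K x).2 fun y _ => hK₁ x y
  let K' : LieSubalgebra R L :=
    { (R ∙ x) ⊔ (K : Submodule R L) with
      lie_mem' := fun {y z} => LieSubalgebra.lie_mem_sup_of_mem_normalizer hx₁ }
  have hxK' : x ∈ K' := Submodule.mem_sup_left (Submodule.subset_span (Set.mem_singleton _))
  have hKK' : K ≤ K' := (LieSubalgebra.toSubmodule_le_toSubmodule K K').mp le_sup_right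
  have hK' : K' ≤ K.normalizer := fun y _ =>
    (LieSubalgebra.mem_normalizer_iff K y).2 fun z _ => hK₁ y z
  -- `K` is an ideal of `K'`, and `K'` is spanned by `K` and `x`, which acts nilpotently: the
  -- inductive step of Engel's theorem applies and contradicts maximality.
  refine hmax K' ⟨fun y z => hKK' (hK₁ y z), ?_⟩
    (lt_iff_le_and_ne.mpr ⟨hKK', fun contra => hxK (contra.symm ▸ hxK')⟩)
  obtain ⟨I, hI₁ : (I : LieSubalgebra R K') = LieSubalgebra.ofLe hKK'⟩ :=
    LieSubalgebra.exists_nested_lieIdeal_ofLe_normalizer hKK' hK'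
  have hI₂ : R ∙ (⟨x, hxK'⟩ : K') ⊔ LieSubmodule.toSubmodule I = ⊤ := by
    rw [← LieIdeal.toLieSubalgebra_toSubmodule R K' I, hI₁]
    apply Submodule.map_injective_of_injective (K' : Submodule R L).injective_subtype
    simp only [LieSubalgebra.coe_ofLe, Submodule.map_sup, Submodule.map_subtype_range_inclusion,
      Submodule.map_top, Submodule.range_subtype]
    rw [Submodule.map_subtype_span_singleton]
  let e : K ≃ₗ⁅R⁆ I :=
    (LieSubalgebra.equivOfLe hKK').trans
      (LieEquiv.ofEq _ _ ((LieSubalgebra.coe_set_eq _ _).mpr hI₁.symm))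
  have hI₃ : LieModule.IsNilpotent I M := by
    exact Function.Surjective.lieModuleIsNilpotent (f := e.toLieHom) (g := LinearMap.id)
      (fun y m => rfl) e.surjective Function.surjective_id
  exact LieSubmodule.isNilpotentOfIsNilpotentSpanSupEqTop hI₂ (hnil x hxΩ) hI₃

end Engel

/-! ### The radical of the Killing form contains the nonzero weights and acts nilpotently. -/

section NilpotentIdeal

variable {L : Type*} [LieRing L] [LieAlgebra ℝ L] {ι : Type*} [Fintype ι]

theorem weightMap_lie (b : Module.Basis ι ℝ L) (ρ : ι → ℝ)
    (hgr : ∀ i j, ⁅b i, b j⁆ ∈ Submodule.span ℝ (b '' {k | ρ k = ρ i + ρ j})) (x y : L) :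
    weightMap b ρ ⁅x, y⁆ = ⁅weightMap b ρ x, y⁆ + ⁅x, weightMap b ρ y⁆ := by
  have hspan : ∀ (r : ℝ) (z : L), z ∈ Submodule.span ℝ (b '' {k | ρ k = r}) →
      weightMap b ρ z = r • z := by
    intro r z hz
    induction hz using Submodule.span_induction with
    | mem z hz => obtain ⟨k, hk, rfl⟩ := hz; rw [weightMap_basis, hk]
    | zero => simp
    | add x y _ _ hx hy => rw [map_add, hx, hy, smul_add]
    | smul a x _ hx => rw [map_smul, hx, smul_comm]
  let B : L →ₗ[ℝ] L →ₗ[ℝ] L := LieModule.toEnd ℝ L L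
  suffices h : B.compr₂ (weightMap b ρ) =
      B ∘ₗ weightMap b ρ + B.compl₂ (weightMap b ρ) from
    LinearMap.congr_fun₂ h x y
  refine b.ext fun i => b.ext fun j => ?_
  change weightMap b ρ ⁅b i, b j⁆ = ⁅weightMap b ρ (b i), b j⁆ + ⁅b i, weightMap b ρ (b j)⁆
  rw [hspan _ _ (hgr i j), weightMap_basis, weightMap_basis, smul_lie, lie_smul, add_smul]

variable [FiniteDimensional ℝ L]

/-- In `D [x, y] = [D x, y] + [x, D y]` the first term is controlled because `D` maps everything
into `K`, the second by induction. -/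
theorem lcs_mem_of_derivation (D : L →ₗ[ℝ] L) (hder : ∀ x y, D ⁅x, y⁆ = ⁅D x, y⁆ + ⁅x, D y⁆)
    (K : LieIdeal ℝ L) (hK : ∀ x, D x ∈ K) (n : ℕ) :
    ∀ x ∈ K.lcs L n, D x ∈ K.lcs L n := by
  induction n with
  | zero => intro x _; exact LieSubmodule.mem_top _
  | succ n ih =>
    intro x hx
    rw [LieIdeal.lcs_succ] at hx ⊢
    rw [← LieSubmodule.mem_toSubmodule, LieSubmodule.lieIdeal_oper_eq_linear_span'] at hx
    induction hx using Submodule.span_induction with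
    | zero => rw [map_zero]; exact LieSubmodule.zero_mem _
    | add x y _ _ hx hy => rw [map_add]; exact add_mem hx hy
    | smul a x _ hx => rw [map_smul]; exact SMulMemClass.smul_mem a hx
    | mem z hz =>
      obtain ⟨x, hx, y, hy, rfl⟩ := hz
      rw [hder]
      exact add_mem (LieSubmodule.lie_mem_lie (hK x) hy)
        (LieSubmodule.lie_mem_lie hx (ih y hy))

theorem lie_mem_lcs_succ (K : LieIdeal ℝ L) (n : ℕ) {k x : L} (hk : k ∈ K) (hx : x ∈ K.lcs L n) :
    ⁅k, x⁆ ∈ K.lcs L (n + 1) := by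
  rw [LieIdeal.lcs_succ]
  exact LieSubmodule.lie_mem_lie hk hx

/-- If the kernel of a diagonal derivation `D` acts by infinitesimal isometries of an inner product
for which `D` is symmetric, then the range of `D` lies in an ideal which acts nilpotently. -/
theorem exists_nilpotent_lieIdeal (b : Module.Basis ι ℝ L) (ρ : ι → ℝ)
    (hder : ∀ x y, weightMap b ρ ⁅x, y⁆ = ⁅weightMap b ρ x, y⁆ + ⁅x, weightMap b ρ y⁆)
    (Q : L →ₗ[ℝ] L →ₗ[ℝ] ℝ) (hsymm : ∀ x y, Q x y = Q y x) (hpos : ∀ x, x ≠ 0 → 0 < Q x x)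
    (hQD : ∀ x y, Q (weightMap b ρ x) y = Q x (weightMap b ρ y))
    (hskew : ∀ z, weightMap b ρ z = 0 → ∀ y, Q ⁅z, y⁆ y = 0) :
    ∃ K : LieIdeal ℝ L, (∀ x, weightMap b ρ x ∈ K) ∧ ∃ N, K.lcs L N = ⊥ := by
  classical
  set D : Module.End ℝ L := weightMap b ρ with hDdef
  have hcomm : ∀ x, D * LieAlgebra.ad ℝ L x - LieAlgebra.ad ℝ L x * D = LieAlgebra.ad ℝ L (D x) :=
    fun x => by
      ext y
      simp only [LinearMap.sub_apply, Module.End.mul_apply, LieAlgebra.ad_apply, hder]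
      abel
  have htr : ∀ x, LinearMap.trace ℝ L (D * LieAlgebra.ad ℝ L x) = 0 := by
    suffices h : LinearMap.trace ℝ L ∘ₗ LinearMap.mulLeft ℝ D ∘ₗ
        (LieAlgebra.ad ℝ L : L →ₗ[ℝ] Module.End ℝ L) = 0 from fun x => DFunLike.congr_fun h x
    refine b.ext fun i => ?_
    change LinearMap.trace ℝ L (D * LieAlgebra.ad ℝ L (b i)) = 0
    set A := LieAlgebra.ad ℝ L (b i) with hA
    have hDA : D * A - A * D = ρ i • A := by
      rw [hA, hcomm, hDdef, weightMap_basis, map_smul]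
    by_cases hi : ρ i = 0
    · have h1 : ∀ x, Q (A x) x = 0 := hskew (b i) (by rw [weightMap_basis, hi, zero_smul])
      -- The `Q`-adjoint of `D A` is `-A D`, since `D` is symmetric and `A` skew; hence the trace
      -- equals its own negative.
      have h2 : LinearMap.trace ℝ L (D * A) = LinearMap.trace ℝ L (-(A * D)) := by
        refine trace_eq_of_adjoint Q hsymm hpos fun x y => ?_
        change Q (D (A x)) y = Q x (-(A (D y)))
        rw [hQD, skew_polarize hsymm h1, map_neg]
      rw [map_neg, LinearMap.trace_mul_comm ℝ A D] at h2
      linarith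
    -- Here `ρ i • A = D A - A D`, and the trace of `D (D A - A D)` vanishes by cyclicity.
    · have h1 : LinearMap.trace ℝ L (D * (ρ i • A)) = 0 := by
        rw [← hDA, mul_sub, map_sub, ← mul_assoc D A D, LinearMap.trace_mul_comm ℝ (D * A) D,
          sub_self]
      rw [mul_smul_comm, map_smul, smul_eq_mul] at h1
      exact (mul_eq_zero.1 h1).resolve_left hi
  have hkill : ∀ x y, killingForm ℝ L (D x) y = 0 := fun x y => by
    change LinearMap.trace ℝ L (LieAlgebra.ad ℝ L (D x) * LieAlgebra.ad ℝ L y) = 0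
    have h := htr ⁅x, y⁆
    have had : LieAlgebra.ad ℝ L ⁅x, y⁆ = LieAlgebra.ad ℝ L x * LieAlgebra.ad ℝ L y -
        LieAlgebra.ad ℝ L y * LieAlgebra.ad ℝ L x := by
      ext z
      simp only [LinearMap.sub_apply, Module.End.mul_apply, LieAlgebra.ad_apply, lie_lie]
    rw [had, mul_sub, map_sub] at h
    rw [← hcomm, sub_mul, map_sub, mul_assoc, mul_assoc,
      LinearMap.trace_mul_comm ℝ (LieAlgebra.ad ℝ L x) (D * LieAlgebra.ad ℝ L y), mul_assoc]
    exact h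
  set K : LieIdeal ℝ L := LieIdeal.killingCompl ℝ L ⊤ with hKdef
  have hmemK : ∀ x, x ∈ K ↔ ∀ y, killingForm ℝ L x y = 0 := fun x => by
    rw [hKdef, LieIdeal.mem_killingCompl]
    exact ⟨fun h y => by rw [LieModule.traceForm_comm]; exact h y (LieSubmodule.mem_top y),
      fun h y _ => by rw [LieModule.traceForm_comm]; exact h y⟩
  have hDK : ∀ x, D x ∈ K := fun x => (hmemK _).2 (hkill x)
  refine ⟨K, hDK, ?_⟩
  -- `ad k` is skew because `D k = 0`, and `tr (ad k)² = 0` because `k` is in the Killing radical.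
  have hcentral : ∀ k ∈ K, D k = 0 → LieAlgebra.ad ℝ L k = 0 := fun k hk hDk =>
    eq_zero_of_skew_of_trace_mul_self Q hsymm hpos (hskew k hDk) ((hmemK k).1 hk k)
  have hnilp : LieModule.IsNilpotent K L := by
    refine lieModule_isNilpotent_of_span (R := ℝ) (Ω := {x : K | ∃ r : ℝ, D x = r • (x : L)})
      ?_ ?_ ?_
    · rw [eq_top_iff]
      rintro ⟨x, hx⟩ -
      have hmem : ∀ r, weightProj b ρ {r} x ∈ K := fun r =>
        weightProj_mem b ρ (F := K.toSubmodule) (fun x _ => hDK x) {r} hx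
      have : (⟨x, hx⟩ : K) = ∑ r ∈ Finset.univ.image ρ, ⟨weightProj b ρ {r} x, hmem r⟩ := by
        apply Subtype.ext
        rw [AddSubmonoidClass.coe_finsetSum]
        exact (sum_weightProj_singleton b ρ x).symm
      rw [this]
      exact Submodule.sum_mem _ fun r _ => Submodule.subset_span
        ⟨r, weightMap_weightProj_singleton b ρ r x⟩
    · rintro ⟨x, hx⟩ ⟨r, hr⟩
      change IsNilpotent (LieAlgebra.ad ℝ L x)
      rcases eq_or_ne r 0 with rfl | hr0
      · rw [hcentral x hx (by rw [hr]; exact zero_smul ℝ x)]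
        exact IsNilpotent.zero
      · refine isNilpotent_of_commutator_eq_smul (S := D) hr0 ?_
        rw [hcomm, ← map_smul]
        exact congrArg _ hr
    -- Cartan's criterion: the trace form of `K` acting on `L` is the restricted Killing form, which
    -- is zero.
    · refine LieModule.isNilpotent_derivedSeries_of_traceForm_eq_zero (R := ℝ) (L := K) (M := L) ?_
      ext ⟨x, hx⟩ ⟨y, hy⟩
      exact (hmemK x).1 hx y
  obtain ⟨N, hN⟩ := (LieModule.isNilpotent_iff ℝ K L).1 hnilp
  exact ⟨N, by simp only [← LieSubmodule.toSubmodule_inj, K.coe_lcs_eq, hN,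
    LieSubmodule.bot_toSubmodule]⟩

end NilpotentIdeal

/-! ### Averaging an inner product over a compact group. -/

section Averaging

open MeasureTheory

variable {E : Type*} [NormedAddCommGroup E] [NormedSpace ℝ E] [FiniteDimensional ℝ E]
  {H : Type*} [Group H] [TopologicalSpace H] [IsTopologicalGroup H] [CompactSpace H]

/-- A bilinear form on a finite-dimensional space, as a continuous one. -/
def continuousForm (q : E →ₗ[ℝ] E →ₗ[ℝ] ℝ) : E →L[ℝ] E →L[ℝ] ℝ :=
  LinearMap.toContinuousLinearMap
    ((LinearMap.toContinuousLinearMap : (E →ₗ[ℝ] ℝ) ≃ₗ[ℝ] (E →L[ℝ] ℝ)).toLinearMap ∘ₗ q)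

/-- Averaging an inner product over a compact group. -/
theorem exists_invariant_form {π : H → E →L[ℝ] E} (hcont : Continuous π)
    (hmul : ∀ g h x, π (g * h) x = π g (π h x)) (hone : ∀ x, π 1 x = x)
    (q : E →ₗ[ℝ] E →ₗ[ℝ] ℝ) (hsymm : ∀ x y, q x y = q y x) (hpos : ∀ x, x ≠ 0 → 0 < q x x) :
    ∃ Q : E →ₗ[ℝ] E →ₗ[ℝ] ℝ, (∀ x y, Q x y = Q y x) ∧ (∀ x, x ≠ 0 → 0 < Q x x) ∧
      (∀ g x y, Q (π g x) (π g y) = Q x y) ∧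
      ∀ S : E → E, (∀ x y, q (S x) y = q x (S y)) → (∀ g x, π g (S x) = S (π g x)) →
        ∀ x y, Q (S x) y = Q x (S y) := by
  let _ : MeasurableSpace H := borel H
  have _ : BorelSpace H := ⟨rfl⟩
  let μ : Measure H := Measure.haar
  have hc : ∀ x y, Continuous fun h : H => q (π h⁻¹ x) (π h⁻¹ y) := fun x y => by
    have h1 : Continuous fun h : H => π h⁻¹ := hcont.comp continuous_inv
    have h2 : Continuous fun h : H => continuousForm q (π h⁻¹ x) (π h⁻¹ y) := by fun_prop
    exact h2
  have hi : ∀ x y, Integrable (fun h : H => q (π h⁻¹ x) (π h⁻¹ y)) μ := fun x y =>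
    (hc x y).integrable_of_hasCompactSupport (HasCompactSupport.of_compactSpace _)
  let Q : E →ₗ[ℝ] E →ₗ[ℝ] ℝ := LinearMap.mk₂ ℝ (fun x y => ∫ h : H, q (π h⁻¹ x) (π h⁻¹ y) ∂μ)
    (fun x x' y => by
      simp only [map_add, LinearMap.add_apply]; exact integral_add (hi x y) (hi x' y))
    (fun c x y => by
      simp only [map_smul, LinearMap.smul_apply]; exact integral_smul c _)
    (fun x y y' => by
      simp only [map_add]; exact integral_add (hi x y) (hi x y'))
    (fun c x y => by
      simp only [map_smul]; exact integral_smul c _)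
  have hQ : ∀ x y, Q x y = ∫ h : H, q (π h⁻¹ x) (π h⁻¹ y) ∂μ := fun x y => rfl
  refine ⟨Q, fun x y => ?_, fun x hx => ?_, fun g x y => ?_, fun S hS hSπ x y => ?_⟩
  · rw [hQ, hQ]
    exact integral_congr_ae (Filter.Eventually.of_forall fun h => hsymm _ _)
  · rw [hQ]
    refine (hc x x).integral_pos_of_hasCompactSupport_nonneg_nonzero
      (HasCompactSupport.of_compactSpace _) (fun h => ?_) (x := 1) ?_
    · by_cases h0 : π h⁻¹ x = 0
      · simp [h0]
      · exact (hpos _ h0).le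
    · rw [inv_one, hone]; exact (hpos x hx).ne'
  · rw [hQ, hQ, ← integral_mul_left_eq_self _ g]
    refine integral_congr_ae (Filter.Eventually.of_forall fun h => ?_)
    simp only [← hmul, mul_inv_rev, inv_mul_cancel_right]
  · rw [hQ, hQ]
    refine integral_congr_ae (Filter.Eventually.of_forall fun h => ?_)
    simp only [hSπ, hS]

end Averaging

/-! ### From a compact connected subgroup to infinitesimal isometries. -/

section Invariant

open Filter Topology Set

variable {E : Type*} [NormedAddCommGroup E] [NormedSpace ℝ E] [CompleteSpace E]
  [FiniteDimensional ℝ E]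
  {G : Type*} [TopologicalSpace G] [T2Space G] [ChartedSpace E G] [Group G]
  [LieGroup 𝓘(ℝ, E) ∞ G]

theorem continuous_Ad : Continuous fun g : G => Ad E g :=
  (contMDiff_Ad (E := E) (G := G)).continuous

/-- Commuting with `ad X` passes to `e^{ad X} = Ad (exp X)`, then to products and inverses. -/
theorem Ad_commute_of_mem {h : Submodule ℝ (GroupLieAlgebra 𝓘(ℝ, E) G)} {S : E →L[ℝ] E}
    (hS : ∀ X : E, X ∈ h → ∀ x, lieBr G X (S x) = S (lieBr G X x)) {g : G}
    (hg : g ∈ connectedSubgroup h) : Commute (Ad E g) S := by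
  induction hg using Subgroup.closure_induction with
  | mem g hg =>
    obtain ⟨X, hX, rfl⟩ := mem_expImage_iff.1 hg
    rw [Ad_expCurve]
    refine Commute.exp_left (Commute.smul_left ?_ _)
    ext x
    exact hS X hX x
  | one =>
    rw [Ad_one]; exact Commute.one_left S
  | mul g h _ _ hg hh => rw [Ad_mul]; exact Commute.mul_left hg hh
  | inv g _ hg =>
    ext x
    have h1 := DFunLike.congr_fun hg (Ad E g⁻¹ x)
    change Ad E g (S (Ad E g⁻¹ x)) = S (Ad E g (Ad E g⁻¹ x)) at h1
    rw [Ad_self_apply_inv] at h1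
    change Ad E g⁻¹ (S x) = S (Ad E g⁻¹ x)
    rw [← h1, Ad_inv_apply_self]

/-- Compactness of a connected Lie subgroup turns its Lie algebra into infinitesimal isometries. -/
theorem exists_form_of_isCompact {h : Submodule ℝ (GroupLieAlgebra 𝓘(ℝ, E) G)}
    (hcompact : IsCompact (connectedSubgroup h : Set G))
    (q : E →ₗ[ℝ] E →ₗ[ℝ] ℝ) (hsymm : ∀ x y, q x y = q y x) (hpos : ∀ x, x ≠ 0 → 0 < q x x)
    (S : E →ₗ[ℝ] E) (hqS : ∀ x y, q (S x) y = q x (S y))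
    (hS : ∀ X : E, X ∈ h → ∀ x, lieBr G X (S x) = S (lieBr G X x)) :
    ∃ Q : E →ₗ[ℝ] E →ₗ[ℝ] ℝ, (∀ x y, Q x y = Q y x) ∧ (∀ x, x ≠ 0 → 0 < Q x x) ∧
      (∀ x y, Q (S x) y = Q x (S y)) ∧ ∀ X : E, X ∈ h → ∀ y, Q (lieBr G X y) y = 0 := by
  have _ : IsTopologicalGroup G := topologicalGroup_of_lieGroup 𝓘(ℝ, E) ∞
  have _ : CompactSpace (connectedSubgroup h) := isCompact_iff_compactSpace.1 hcompact
  obtain ⟨Q, h1, h2, h3, h4⟩ := exists_invariant_form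
    (H := connectedSubgroup h) (π := fun g => Ad E (g : G))
    (continuous_Ad.comp continuous_subtype_val) (fun g h x => Ad_mul_apply _ _ x)
    (fun x => by change Ad E (1 : G) x = x; rw [Ad_one]; rfl) q hsymm hpos
  refine ⟨Q, h1, h2, h4 S hqS fun g x => ?_, fun X hX y => ?_⟩
  · exact DFunLike.congr_fun
      (Ad_commute_of_mem (S := LinearMap.toContinuousLinearMap S) hS g.2) x
  · have hd : HasDerivAt (fun s => Ad E (expCurve G X s) y) (lieBr G X y) 0 := by
      have := (hasLogDeriv_expCurve (G := G) X 0).hasDerivAt_Ad_const y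
      rwa [expCurve_zero, Ad_one] at this
    have hd2 := (((continuousForm Q).hasFDerivAt.comp_hasDerivAt 0 hd)).clm_apply hd
    -- Invariance makes `Q (Ad (exp sX) y) (Ad (exp sX) y)` constant; its derivative at `0` is `2 Q
    -- [X, y] y`.
    have hconst : (fun s => continuousForm Q (Ad E (expCurve G X s) y) (Ad E (expCurve G X s) y)) =
        fun _ => Q y y := by
      funext s
      exact h3 ⟨expCurve G X s, expCurve_mem_connectedSubgroup hX s⟩ y y
    have hd3 : HasDerivAt (fun _ : ℝ => Q y y) _ 0 := hconst ▸ hd2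
    have h5 := hd3.unique (hasDerivAt_const 0 _)
    simp only [Function.comp_apply, expCurve_zero, Ad_one] at h5
    change Q (lieBr G X y) y + Q y (lieBr G X y) = 0 at h5
    rw [h1 y] at h5
    linarith

end Invariant

/-! ### Global solutions of strictly triangular equations. -/

section Picard

open MeasureTheory

variable {E : Type*} [NormedAddCommGroup E] [NormedSpace ℝ E] [FiniteDimensional ℝ E]

/-- A linear projection onto `F` commutes with the integral and fixes the integrand. -/
theorem intervalIntegral_mem (F : Submodule ℝ E) {f : ℝ → E} (hf : Continuous f)
    (hF : ∀ t, f t ∈ F) (a b : ℝ) : ∫ t in a..b, f t ∈ F := by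
  have _ : CompleteSpace E := FiniteDimensional.complete ℝ E
  obtain ⟨p, hp⟩ := F.subtype.exists_leftInverse_of_injective F.ker_subtype
  have h1 : ∀ x ∈ F, F.subtype (p x) = x := fun x hx => by
    have := DFunLike.congr_fun hp ⟨x, hx⟩
    exact congrArg Subtype.val this
  let P : E →L[ℝ] E := LinearMap.toContinuousLinearMap (F.subtype ∘ₗ p)
  have h2 := P.intervalIntegral_comp_comm (hf.intervalIntegrable (μ := volume) a b)
  have h3 : (fun t => P (f t)) = f := funext fun t => h1 _ (hF t)
  rw [h3] at h2
  rw [h2]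
  exact (p _).2

/-- The Picard iteration becomes stationary for a vector field which is strictly triangular with
respect to a finite filtration. -/
theorem exists_global_solution {B : E → E} (hB : Continuous B) {K : Submodule ℝ E}
    {F : ℕ → Submodule ℝ E} (hF0 : F 0 = ⊤) {N : ℕ} (hFN : F N = ⊥)
    (hBK : ∀ x ∈ K, B x ∈ K)
    (hBF : ∀ n, ∀ x ∈ K, ∀ y ∈ K, x - y ∈ F n → B x - B y ∈ F (n + 1)) {k : E} (hk : k ∈ K) :
    ∃ w : ℝ → E, w 0 = k ∧ ∀ t, w t ∈ K ∧ HasDerivAt w (B (w t)) t := by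
  have _ : CompleteSpace E := FiniteDimensional.complete ℝ E
  let w : ℕ → ℝ → E := fun n => Nat.rec (fun _ => k) (fun _ v t => k + ∫ s in (0 : ℝ)..t, B (v s)) n
  have hw : ∀ n t, w (n + 1) t = k + ∫ s in (0 : ℝ)..t, B (w n s) := fun n t => rfl
  have hmain : ∀ n, Continuous (w n) ∧ ∀ t, w n t ∈ K := by
    intro n
    induction n with
    | zero => exact ⟨continuous_const, fun _ => hk⟩
    | succ n ih =>
      have hc : Continuous fun s => B (w n s) := hB.comp ih.1
      refine ⟨?_, fun t => ?_⟩
      · exact continuous_const.add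
          (intervalIntegral.continuous_primitive (fun a b => hc.intervalIntegrable a b) 0)
      · rw [hw]
        exact K.add_mem hk (intervalIntegral_mem K hc (fun s => hBK _ (ih.2 s)) 0 t)
  -- Each iteration moves the difference of consecutive iterates one step down the filtration, so
  -- the iterate `N` is already a fixed point.
  have hd : ∀ n t, w (n + 1) t - w n t ∈ F n := by
    intro n
    induction n with
    | zero => intro t; rw [hF0]; trivial
    | succ n ih =>
      intro t
      have hc : ∀ n, Continuous fun s => B (w n s) := fun n => hB.comp (hmain n).1
      rw [hw (n + 1), hw n, add_sub_add_left_eq_sub, ← intervalIntegral.integral_sub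
        ((hc (n + 1)).intervalIntegrable 0 t) ((hc n).intervalIntegrable 0 t)]
      exact intervalIntegral_mem _ ((hc (n + 1)).sub (hc n) :
          Continuous fun s => B (w (n + 1) s) - B (w n s))
        (fun s => hBF n _ ((hmain (n + 1)).2 s) _ ((hmain n).2 s) (ih s)) 0 t
  have hstat : w (N + 1) = w N := funext fun t => by
    have := hd N t
    rw [hFN, Submodule.mem_bot] at this
    exact sub_eq_zero.1 this
  refine ⟨w N, ?_, fun t => ⟨(hmain N).2 t, ?_⟩⟩
  · rw [← hstat, hw, intervalIntegral.integral_same, add_zero]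
  · have hc : Continuous fun s => B (w N s) := hB.comp (hmain N).1
    have := (hc.integral_hasStrictDerivAt 0 t).hasDerivAt.const_add k
    refine (this.congr_of_eventuallyEq (Filter.Eventually.of_forall fun s => ?_))
    exact (congrFun hstat s).symm.trans (hw N s)

end Picard

/-! ### Splitting `exp K`, then the whole group. -/

section Core

open Filter Topology Set

variable {E : Type*} [NormedAddCommGroup E] [NormedSpace ℝ E] [CompleteSpace E]
  [FiniteDimensional ℝ E]
  {G : Type*} [TopologicalSpace G] [T2Space G] [ChartedSpace E G] [Group G]
  [LieGroup 𝓘(ℝ, E) ∞ G]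

theorem expCurve_neg (X : E) (t : ℝ) : expCurve G X (-t) = (expCurve G X t)⁻¹ := by
  have ha : ∀ s, HasLogDeriv (fun s => expCurve G X (s - t)) X s := fun s => by
    have := (hasLogDeriv_expCurve (G := G) X (s - t)).comp_real
      (τ := fun s => s - t) ((hasDerivAt_id s).sub_const t)
    simpa using this
  obtain ⟨T, hT⟩ := exists_abs_lt t
  have h := HasLogDeriv.eq_translate (u := fun _ => X) (p := -T) (q := T) (fun s _ => ha s)
    (fun s _ => hasLogDeriv_expCurve X s) (s := 0) (t := t)
    ⟨by linarith [hT.1], hT.1⟩ (abs_lt.1 hT.2)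
  simp only [sub_self, zero_sub, expCurve_zero, inv_one, mul_one] at h
  exact eq_inv_of_mul_eq_one_left h.symm

theorem lieBr_add_left (x x' y : E) : lieBr G (x + x') y = lieBr G x y + lieBr G x' y :=
  add_lie (L := GroupLieAlgebra 𝓘(ℝ, E) G) (M := GroupLieAlgebra 𝓘(ℝ, E) G) x x' y

theorem lieBr_smul_left (r : ℝ) (x y : E) : lieBr G (r • x) y = r • lieBr G x y :=
  smul_lie (L := GroupLieAlgebra 𝓘(ℝ, E) G) (M := GroupLieAlgebra 𝓘(ℝ, E) G) r x y

theorem continuous_adL : Continuous fun X : E => adL G X :=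
  (LinearMap.toContinuousLinearMap
    { toFun := fun X : E => adL G X
      map_add' := fun X Y => ContinuousLinearMap.ext fun Z => lieBr_add_left X Y Z
      map_smul' := fun r X => ContinuousLinearMap.ext fun Z => lieBr_smul_left r X Z }).continuous

theorem lieBr_mem_span {ι : Type*} {b : ι → E} {p : Submodule ℝ E} {s t : Set ι}
    (h : ∀ i ∈ s, ∀ j ∈ t, lieBr G (b i) (b j) ∈ p) {x y : E}
    (hx : x ∈ Submodule.span ℝ (b '' s)) (hy : y ∈ Submodule.span ℝ (b '' t)) :
    lieBr G x y ∈ p := by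
  have hzero : ∀ y : E, lieBr G 0 y = 0 := fun y =>
    zero_lie (L := GroupLieAlgebra 𝓘(ℝ, E) G) (M := GroupLieAlgebra 𝓘(ℝ, E) G) y
  induction hx using Submodule.span_induction with
  | zero => rw [hzero]; exact p.zero_mem
  | add x x' _ _ hx hx' => rw [lieBr_add_left]; exact p.add_mem hx hx'
  | smul r x _ hx => rw [lieBr_smul_left]; exact p.smul_mem r hx
  | mem x hx =>
    obtain ⟨i, hi, rfl⟩ := hx
    simp only [← adL_apply] at h ⊢
    induction hy using Submodule.span_induction with
    | zero => rw [map_zero]; exact p.zero_mem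
    | add y y' _ _ hy hy' => rw [map_add]; exact p.add_mem hy hy'
    | smul r y _ hy => rw [map_smul]; exact p.smul_mem r hy
    | mem y hy =>
      obtain ⟨j, hj, rfl⟩ := hy
      exact h i hi j hj

theorem expCurve_mem_expClosure_of_mem_span {ι : Type*} [Fintype ι] {e : ι → E}
    (hli : LinearIndependent ℝ e)
    (hlie : ∀ x ∈ Submodule.span ℝ (range e), ∀ y ∈ Submodule.span ℝ (range e),
      lieBr G x y ∈ Submodule.span ℝ (range e)) {X : E} (hX : X ∈ Submodule.span ℝ (range e))
    (t : ℝ) : expCurve G X t ∈ expClosure G e := by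
  obtain ⟨T, hT⟩ := exists_abs_lt t
  have := HasLogDeriv.inv_mul_mem hli hlie (u := fun _ => X) (p := -T) (q := T)
    (fun s _ => hasLogDeriv_expCurve (G := G) X s) (fun s _ => ⟨continuousAt_const, hX⟩)
    (s := 0) (t := t) ⟨by linarith [hT.1], hT.1⟩ (abs_lt.1 hT.2)
  simpa [expCurve_zero] using this

theorem Ad_mem_of_mem_expClosure {ι : Type*} {e : ι → E} {p : Submodule ℝ E}
    (hp : ∀ i, ∀ x ∈ p, lieBr G (e i) x ∈ p) {g : G} (hg : g ∈ expClosure G e) :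
    ∀ x ∈ p, Ad E g x ∈ p := by
  have hexp : ∀ i t, ∀ x ∈ p, Ad E (expCurve G (e i) t) x ∈ p := fun i t x hx => by
    rw [Ad_expCurve]
    exact exp_apply_mem (fun x hx => p.smul_mem t (hp i x hx)) hx
  suffices h : ∀ x ∈ p, Ad E g x ∈ p ∧ Ad E g⁻¹ x ∈ p from fun x hx => (h x hx).1
  induction hg using Subgroup.closure_induction with
  | one => intro x hx; rw [inv_one, Ad_one]; exact ⟨hx, hx⟩
  | mul g h _ _ hg hh =>
    intro x hx
    rw [mul_inv_rev, Ad_mul_apply, Ad_mul_apply]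
    exact ⟨(hg _ (hh x hx).1).1, (hh _ (hg x hx).2).2⟩
  | mem g hg =>
    obtain ⟨i, t, rfl⟩ := hg
    intro x hx
    rw [← expCurve_neg]
    exact ⟨hexp i t x hx, hexp i (-t) x hx⟩
  | inv g _ hg =>
    intro x hx
    rw [inv_inv]
    exact (hg x hx).symm

/-- Splitting of `exp k` along a global solution of the equation `w' = [u w, w]`. -/
theorem expCurve_mem_mul {ι κ : Type*} [Fintype ι] [Fintype κ] {e : ι → E} {f : κ → E}
    (he : LinearIndependent ℝ e)
    (hlie : ∀ x ∈ Submodule.span ℝ (range e), ∀ y ∈ Submodule.span ℝ (range e),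
      lieBr G x y ∈ Submodule.span ℝ (range e))
    (hf : LinearIndependent ℝ f)
    (hlif : ∀ x ∈ Submodule.span ℝ (range f), ∀ y ∈ Submodule.span ℝ (range f),
      lieBr G x y ∈ Submodule.span ℝ (range f))
    {w u v : ℝ → E} {k : E} (hw0 : w 0 = k) (huc : Continuous u) (hvc : Continuous v)
    (huv : ∀ t, u t + v t = w t)
    (hu : ∀ t, u t ∈ Submodule.span ℝ (range e)) (hv : ∀ t, v t ∈ Submodule.span ℝ (range f))
    (hw : ∀ t, HasDerivAt w (lieBr G (u t) (w t)) t) :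
    ∃ p ∈ expClosure G f, ∃ m ∈ expClosure G e, p * m = expCurve G k 1 := by
  -- `g` plays the role of `γ t`. Keeping `Ad g (w t) = k` in the statement lets local curves be
  -- glued without building one curve over all of `[0, 1]`.
  let T : ℝ → Prop := fun t => ∃ g ∈ expClosure G e, Ad E g (w t) = k ∧
    expCurve G k t * g ∈ expClosure G f
  have hstep : ∀ t₀ : ℝ, ∃ ε > 0, ∀ s ∈ Ioo (t₀ - ε) (t₀ + ε), ∀ t ∈ Ioo (t₀ - ε) (t₀ + ε),
      T s → T t := by
    intro t₀
    obtain ⟨c, hc, hcd⟩ := exists_local_curve (G := G) he hlie (u := fun t => - u t) (t₀ := t₀)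
      (Eventually.of_forall fun t => ⟨huc.neg.continuousAt, Submodule.neg_mem _ (hu t)⟩)
    obtain ⟨d, hd, hdd⟩ := exists_local_curve (G := G) hf hlif (u := v) (t₀ := t₀)
      (Eventually.of_forall fun t => ⟨hvc.continuousAt, hv t⟩)
    obtain ⟨ε, hε, hball⟩ := Metric.eventually_nhds_iff.1 (hcd.and hdd)
    have hI : ∀ t ∈ Ioo (t₀ - ε) (t₀ + ε), dist t t₀ < ε := by
      intro t ht
      rw [Real.dist_eq, abs_lt]
      constructor <;> linarith [ht.1, ht.2]
    refine ⟨ε, hε, ?_⟩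
    rintro s hs t ht ⟨g, hg, hgk, hgf⟩
    -- The derivative of `Ad c w` is `Ad c ([-u, w] + w')`, which is zero by the equation for `w`.
    have hconst : ∀ t ∈ Ioo (t₀ - ε) (t₀ + ε), Ad E (c t) (w t) = Ad E (c s) (w s) := by
      intro t ht
      have hder : ∀ r ∈ Ioo (t₀ - ε) (t₀ + ε), HasDerivAt (fun r => Ad E (c r) (w r)) 0 r := by
        intro r hr
        have h := (hball (hI r hr)).1.hasDerivAt_Ad (hw r)
        have hz : lieBr G (- u r) (w r) + lieBr G (u r) (w r) = 0 := by
          have : lieBr G (- u r) (w r) = - lieBr G (u r) (w r) :=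
            neg_lie (L := GroupLieAlgebra 𝓘(ℝ, E) G) (M := GroupLieAlgebra 𝓘(ℝ, E) G) (u r) (w r)
          rw [this, neg_add_cancel]
        rwa [hz, map_zero] at h
      exact isOpen_Ioo.is_const_of_deriv_eq_zero isPreconnected_Ioo
        (fun r hr => (hder r hr).differentiableAt.differentiableWithinAt)
        (fun r hr => (hder r hr).deriv) ht hs
    let γ : ℝ → G := fun t => g * (c s)⁻¹ * c t
    have hγk : ∀ t ∈ Ioo (t₀ - ε) (t₀ + ε), Ad E (γ t) (w t) = k := by
      intro t ht
      rw [Ad_mul_apply, hconst t ht, ← Ad_mul_apply, inv_mul_cancel_right, hgk]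
    have hγe : ∀ t, γ t ∈ expClosure G e := fun t =>
      mul_mem (mul_mem hg (inv_mem (hc s))) (hc t)
    have hlog : ∀ t ∈ Ioo (t₀ - ε) (t₀ + ε),
        HasLogDeriv (fun t => expCurve G k t * γ t) (v t) t := by
      intro t ht
      have h1 : HasLogDeriv γ (- u t) t := (hball (hI t ht)).1.const_mul _
      have h2 := (hasLogDeriv_expCurve (G := G) k t).mul h1
      -- Since `Ad γ w = k`, the product rule leaves `w - u = v`, tangent to the span of `f`.
      have h3 : Ad E (γ t)⁻¹ k + - u t = v t := by
        rw [← hγk t ht, Ad_inv_apply_self, ← huv t]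
        abel
      rwa [h3] at h2
    refine ⟨γ t, hγe t, hγk t ht, ?_⟩
    have h := HasLogDeriv.eq_translate hlog (fun t ht => (hball (hI t ht)).2) hs ht
    refine (congrArg (· ∈ expClosure G f) h).mpr ?_
    have hγs : γ s = g := inv_mul_cancel_right g (c s)
    rw [hγs]
    exact mul_mem (mul_mem hgf (inv_mem (hd s))) (hd t)
  have hT0 : T 0 := ⟨1, one_mem _, by rw [Ad_one, hw0]; rfl, by
    rw [expCurve_zero, mul_one]; exact one_mem _⟩
  have hT1 : T 0 ↔ T 1 := by
    refine isPreconnected_univ.induction₂ (fun s t : ℝ => T s ↔ T t) ?_ ?_ ?_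
      (mem_univ _) (mem_univ _)
    · intro x _
      obtain ⟨ε, hε, h⟩ := hstep x
      have hx : x ∈ Ioo (x - ε) (x + ε) := ⟨by linarith, by linarith⟩
      rw [nhdsWithin_univ]
      filter_upwards [Ioo_mem_nhds hx.1 hx.2] with y hy
      exact ⟨h x hx y hy, h y hy x hx⟩
    · intro x y z _ _ _ h1 h2; exact h1.trans h2
    · intro x y _ _ h; exact h.symm
  obtain ⟨g, hg, -, hgf⟩ := hT1.1 hT0
  exact ⟨_, hgf, g⁻¹, inv_mem hg, mul_inv_cancel_right _ _⟩

theorem conj_mem_expClosure {ι : Type*} [Fintype ι] {e : ι → E} (he : LinearIndependent ℝ e)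
    (hlie : ∀ x ∈ Submodule.span ℝ (range e), ∀ y ∈ Submodule.span ℝ (range e),
      lieBr G x y ∈ Submodule.span ℝ (range e)) {g : G}
    (hg : ∀ i, Ad E g (e i) ∈ Submodule.span ℝ (range e)) {m : G} (hm : m ∈ expClosure G e) :
    g * m * g⁻¹ ∈ expClosure G e := by
  induction hm using Subgroup.closure_induction with
  | one => rw [mul_one, mul_inv_cancel]; exact one_mem _
  | mul x y _ _ hx hy =>
    have : g * (x * y) * g⁻¹ = (g * x * g⁻¹) * (g * y * g⁻¹) := by group
    rw [this]
    exact mul_mem hx hy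
  | inv x _ hx =>
    have : g * x⁻¹ * g⁻¹ = (g * x * g⁻¹)⁻¹ := by group
    rw [this]
    exact inv_mem hx
  | mem x hx =>
    obtain ⟨i, t, rfl⟩ := hx
    rw [conj_expCurve]
    exact expCurve_mem_expClosure_of_mem_span he hlie (hg i) t

/-- The product decomposition, when the nonzero weights lie in an ideal which acts nilpotently. -/
theorem exists_mul_eq_of_nilpotent [ConnectedSpace G] {ι : Type*} [Fintype ι]
    (b : Module.Basis ι ℝ E) (ρ : ι → ℝ)
    (hgr : ∀ i j, lieBr G (b i) (b j) ∈ Submodule.span ℝ (b '' {k | ρ k = ρ i + ρ j}))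
    {K : Submodule ℝ E} (hKid : ∀ x, ∀ k ∈ K, lieBr G x k ∈ K) (hK : ∀ i, ρ i ≠ 0 → b i ∈ K)
    {F : ℕ → Submodule ℝ E} (hF0 : F 0 = ⊤) {N : ℕ} (hFN : F N = ⊥)
    (hKF : ∀ n, ∀ k ∈ K, ∀ x ∈ F n, lieBr G k x ∈ F (n + 1))
    (hFD : ∀ n, ∀ x ∈ F n, weightMap b ρ x ∈ F n) (g : G) :
    ∃ p ∈ expClosure G fun i : {i // 0 ≤ ρ i} => b i,
      ∃ m ∈ expClosure G fun i : {i // ρ i < 0} => b i, p * m = g := by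
  have hrange : ∀ q : ι → Prop, range (fun i : {i // q i} => b i) = b '' {i | q i} := fun q => by
    rw [image_eq_range]; rfl
  have hli : ∀ q : ι → Prop, LinearIndependent ℝ fun i : {i // q i} => b i := fun q =>
    b.linearIndependent.comp _ Subtype.val_injective
  have hsub : ∀ q : ℝ → Prop, (∀ r s, q r → q s → q (r + s)) →
      ∀ x ∈ Submodule.span ℝ (range fun i : {i // q (ρ i)} => b i),
      ∀ y ∈ Submodule.span ℝ (range fun i : {i // q (ρ i)} => b i),
        lieBr G x y ∈ Submodule.span ℝ (range fun i : {i // q (ρ i)} => b i) := by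
    intro q hq x hx y hy
    rw [hrange fun i => q (ρ i)] at hx hy ⊢
    refine lieBr_mem_span (fun i hi j hj => ?_) hx hy
    refine Submodule.span_mono (image_mono fun k hk => ?_) (hgr i j)
    have hk' : ρ k = ρ i + ρ j := hk
    rw [Set.mem_ofPred_eq, hk']
    exact hq _ _ hi hj
  have hneg := hsub (fun r => r < 0) fun r s hr hs => by linarith
  have hnonneg := hsub (fun r => 0 ≤ r) fun r s hr hs => by linarith
  set Gm := expClosure G fun i : {i // ρ i < 0} => b i
  set Gp := expClosure G fun i : {i // 0 ≤ ρ i} => b i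
  let P : E →L[ℝ] E := LinearMap.toContinuousLinearMap (weightProj b ρ (Iio 0))
  have hPneg : ∀ x, P x ∈ Submodule.span ℝ (range fun i : {i // ρ i < 0} => b i) := fun x => by
    rw [hrange fun i => ρ i < 0]
    exact weightProj_mem_span b ρ (Iio 0) x
  have hPK : ∀ x, P x ∈ K := fun x => by
    refine Submodule.span_le.2 ?_ (hPneg x)
    rintro _ ⟨i, rfl⟩
    exact hK _ i.2.ne
  have hskew : ∀ x y : E, lieBr G x y = - lieBr G y x := fun x y =>
    (lie_skew (L := GroupLieAlgebra 𝓘(ℝ, E) G) x y).symm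
  have hexpK : ∀ k ∈ K, ∃ p ∈ Gp, ∃ m ∈ Gm, p * m = expCurve G k 1 := by
    intro k hk
    have hB : Continuous fun x => lieBr G (P x) x := by
      have h := (continuous_adL (E := E) (G := G)).comp P.continuous
      exact h.clm_apply continuous_id
    have hBF : ∀ n, ∀ x ∈ K, ∀ y ∈ K, x - y ∈ F n →
        lieBr G (P x) x - lieBr G (P y) y ∈ F (n + 1) := by
      intro n x hx y hy hxy
      -- Writing the difference with one argument in `K` (`P x` or `y`) and the other in `F n` (`x -
      -- y` or `P (x - y)`) gives the gain of one filtration step. `F n` is stable under `P` because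
      -- it is stable under the diagonal map.
      have h1 : lieBr G (P x) x - lieBr G (P y) y =
          lieBr G (P x) (x - y) - lieBr G y (P (x - y)) := by
        rw [hskew (P y) y]
        simp only [← adL_apply, map_sub]
        simp only [adL_apply]
        rw [hskew y (P x)]
        abel
      rw [h1]
      exact (F (n + 1)).sub_mem (hKF n _ (hPK x) _ hxy)
        (hKF n y hy _ (weightProj_mem b ρ (hFD n) (Iio 0) hxy))
    obtain ⟨w, hw0, hw⟩ := exists_global_solution hB hF0 hFN (fun x hx => hKid _ x hx) hBF hk
    have hwc : Continuous w := continuous_iff_continuousAt.2 fun t => (hw t).2.continuousAt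
    refine expCurve_mem_mul (hli _) hneg (hli _) hnonneg (w := w) (u := fun t => P (w t))
      (v := fun t => w t - P (w t)) hw0 (P.continuous.comp hwc)
      (hwc.sub (P.continuous.comp hwc)) (fun t => by abel) (fun t => hPneg _) (fun t => ?_)
      fun t => (hw t).2
    have h1 : w t - P (w t) = weightProj b ρ (Iio 0)ᶜ (w t) := by
      nth_rewrite 1 [← weightProj_add_compl b ρ (Iio 0) (w t)]
      exact add_sub_cancel_left _ _
    rw [h1, hrange fun i => 0 ≤ ρ i]
    have := weightProj_mem_span b ρ (Iio 0)ᶜ (w t)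
    rwa [compl_Iio] at this ⊢
  have hmul : ∀ p ∈ Gp, ∀ m ∈ Gm, ∀ i t, ∃ p' ∈ Gp, ∃ m' ∈ Gm,
      p' * m' = p * m * expCurve G (b i) t := by
    intro p hp m hm i t
    rcases lt_trichotomy (ρ i) 0 with hi | hi | hi
    · exact ⟨p, hp, m * expCurve G (b i) t,
        mul_mem hm (expCurve_mem_expClosure (fun i : {i // ρ i < 0} => b i) ⟨i, hi⟩ t),
        (mul_assoc _ _ _).symm⟩
    · have hz : ∀ t, expCurve G (b i) t ∈ Gp :=
        expCurve_mem_expClosure (fun i : {i // 0 ≤ ρ i} => b i) ⟨i, hi.ge⟩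
      -- Weight zero: the exponential moves to the left past `m`, and conjugating `m` by it stays in
      -- the negative subgroup because `ad (b i)` preserves weights.
      refine ⟨p * expCurve G (b i) t, mul_mem hp (hz t),
        expCurve G (b i) (-t) * m * (expCurve G (b i) (-t))⁻¹,
        conj_mem_expClosure (hli _) hneg (fun j => ?_) hm, ?_⟩
      · rw [Ad_expCurve]
        refine exp_apply_mem (fun x hx => Submodule.smul_mem _ _ ?_)
          (Submodule.subset_span (mem_range_self j))
        rw [hrange fun i => ρ i < 0] at hx ⊢
        refine lieBr_mem_span (b := b) (s := {i}) (fun i' hi' j hj => ?_)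
          (Submodule.subset_span ⟨i, rfl, rfl⟩) hx
        obtain rfl : i' = i := hi'
        refine Submodule.span_mono (image_mono fun k hk => ?_) (hgr i' j)
        have hk' : ρ k = ρ i' + ρ j := hk
        have hj' : ρ j < 0 := hj
        rw [Set.mem_ofPred_eq, hk', hi, zero_add]
        exact hj'
      · rw [expCurve_neg]; group
    -- Positive weight: `m exp (t bᵢ) = exp (Ad m (t bᵢ)) m`, where the exponent lies in the ideal
    -- `K`, so its exponential splits.
    · have hk : Ad E m (t • b i) ∈ K :=
        Ad_mem_of_mem_expClosure (fun j x hx => hKid _ x hx) hm _ (K.smul_mem t (hK i hi.ne'))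
      obtain ⟨p', hp', m', hm', h⟩ := hexpK _ hk
      refine ⟨p * p', mul_mem hp hp', m' * m, mul_mem hm' hm, ?_⟩
      have h2 : m * expCurve G (b i) t * m⁻¹ = p' * m' := by
        rw [h, ← conj_expCurve, expCurve_smul, mul_one]
      calc p * p' * (m' * m) = p * (p' * m') * m := by group
        _ = p * m * expCurve G (b i) t := by rw [← h2]; group
  have hg : g ∈ expClosure G b := by rw [expClosure_basis_eq_top]; trivial
  induction hg using Subgroup.closure_induction_right with
  | one => exact ⟨1, one_mem _, 1, one_mem _, one_mul _⟩
  | mul_right x _ y hy ih =>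
    obtain ⟨i, t, rfl⟩ := hy
    obtain ⟨p, hp, m, hm, rfl⟩ := ih
    exact hmul p hp m hm i t
  | mul_inv_cancel x _ y hy ih =>
    obtain ⟨i, t, rfl⟩ := hy
    obtain ⟨p, hp, m, hm, rfl⟩ := ih
    rw [← expCurve_neg]
    exact hmul p hp m hm i (-t)

end Core

/-! ### A first inner product for which the diagonal map is symmetric. -/

section CoordinateForm

variable {V : Type*} [AddCommGroup V] [Module ℝ V] {ι : Type*} [Fintype ι]
  (b : Module.Basis ι ℝ V) (ρ : ι → ℝ)

/-- The inner product for which a basis is orthonormal. -/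
def coordForm : V →ₗ[ℝ] V →ₗ[ℝ] ℝ := ∑ i, (b.coord i).smulRight (b.coord i)

theorem coordForm_apply (x y : V) : coordForm b x y = ∑ i, b.repr x i * b.repr y i := by
  simp [coordForm, LinearMap.sum_apply]

theorem coordForm_symm (x y : V) : coordForm b x y = coordForm b y x := by
  simp only [coordForm_apply, mul_comm]

theorem coordForm_pos (x : V) (hx : x ≠ 0) : 0 < coordForm b x x := by
  rw [coordForm_apply]
  obtain ⟨i, hi⟩ : ∃ i, b.repr x i ≠ 0 := by
    by_contra! h
    exact hx (b.repr.map_eq_zero_iff.1 (Finsupp.ext h))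
  exact Finset.sum_pos' (fun i _ => mul_self_nonneg _)
    ⟨i, Finset.mem_univ i, mul_self_pos.2 hi⟩

theorem repr_weightMap (x : V) (i : ι) : b.repr (weightMap b ρ x) i = ρ i * b.repr x i := by
  suffices h : b.coord i ∘ₗ weightMap b ρ = ρ i • b.coord i from DFunLike.congr_fun h x
  classical
  refine b.ext fun j => ?_
  simp only [LinearMap.comp_apply, weightMap_basis, map_smul, LinearMap.smul_apply,
    Module.Basis.coord_apply, Module.Basis.repr_self, smul_eq_mul, Finsupp.single_apply]
  split_ifs with h
  · rw [h]
  · simp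

theorem coordForm_weightMap (x y : V) :
    coordForm b (weightMap b ρ x) y = coordForm b x (weightMap b ρ y) := by
  simp only [coordForm_apply, repr_weightMap]
  exact Finset.sum_congr rfl fun i _ => by ring

theorem weightMap_eq_zero_iff (x : V) :
    weightMap b ρ x = 0 ↔ x ∈ Submodule.span ℝ (b '' {i | ρ i ∈ ({0} : Set ℝ)}) := by
  constructor
  · intro h
    rw [← b.sum_repr x]
    refine Submodule.sum_mem _ fun i _ => ?_
    have h1 := repr_weightMap b ρ x i
    rw [h, map_zero, Finsupp.zero_apply] at h1
    rcases mul_eq_zero.1 h1.symm with h2 | h2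
    · exact Submodule.smul_mem _ _ (Submodule.subset_span ⟨i, h2, rfl⟩)
    · rw [h2, zero_smul]; exact Submodule.zero_mem _
  · intro h
    induction h using Submodule.span_induction with
    | zero => rw [map_zero]
    | add x y _ _ hx hy => rw [map_add, hx, hy, add_zero]
    | smul r x _ hx => rw [map_smul, hx, smul_zero]
    | mem x hx =>
      obtain ⟨i, hi, rfl⟩ := hx
      have hi' : ρ i = 0 := hi
      rw [weightMap_basis, hi', zero_smul]

theorem weightMap_neg (x : V) : weightMap b (-ρ) x = - weightMap b ρ x := by
  suffices h : weightMap b (-ρ) = - weightMap b ρ from DFunLike.congr_fun h x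
  refine b.ext fun i => ?_
  rw [LinearMap.neg_apply, weightMap_basis, weightMap_basis, Pi.neg_apply, neg_smul]

end CoordinateForm

/-! ### Assembly. -/

section Main

open Set

variable {E : Type*} [NormedAddCommGroup E] [NormedSpace ℝ E] [FiniteDimensional ℝ E]
  [CompleteSpace E]
  {G : Type*} [TopologicalSpace G] [T2Space G] [ChartedSpace E G] [Group G]
  [LieGroup 𝓘(ℝ, E) ∞ G]

theorem weightMap_lieBr {ι : Type*} [Fintype ι] (b : Module.Basis ι ℝ E) (ρ : ι → ℝ)
    (hgr : ∀ i j, lieBr G (b i) (b j) ∈ Submodule.span ℝ (b '' {k | ρ k = ρ i + ρ j})) (x y : E) :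
    weightMap b ρ (lieBr G x y) = lieBr G (weightMap b ρ x) y + lieBr G x (weightMap b ρ y) :=
  weightMap_lie (L := GroupLieAlgebra 𝓘(ℝ, E) G) b ρ hgr x y

/-- If the connected subgroup with Lie algebra the weight-zero space is compact, there is an inner
product for which the grading derivation is symmetric and the weight-zero space acts by skew maps. -/
theorem exists_form_of_weights {ι : Type*} [Fintype ι] (b : Module.Basis ι ℝ E) (ρ : ι → ℝ)
    (hgr : ∀ i j, lieBr G (b i) (b j) ∈ Submodule.span ℝ (b '' {k | ρ k = ρ i + ρ j}))
    {h : Submodule ℝ (GroupLieAlgebra 𝓘(ℝ, E) G)}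
    (hh : ∀ X : E, X ∈ h ↔ X ∈ Submodule.span ℝ (b '' {i | ρ i ∈ ({0} : Set ℝ)}))
    (hcompact : IsCompact (connectedSubgroup h : Set G)) :
    ∃ Q : E →ₗ[ℝ] E →ₗ[ℝ] ℝ, (∀ x y, Q x y = Q y x) ∧ (∀ x, x ≠ 0 → 0 < Q x x) ∧
      (∀ x y, Q (weightMap b ρ x) y = Q x (weightMap b ρ y)) ∧
      ∀ X : E, X ∈ h → ∀ y, Q (lieBr G X y) y = 0 := by
  refine exists_form_of_isCompact hcompact (coordForm b) (coordForm_symm b) (coordForm_pos b)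
    (weightMap b ρ) (coordForm_weightMap b ρ) fun X hX x => ?_
  have h0 : weightMap b ρ X = 0 := (weightMap_eq_zero_iff b ρ X).2 ((hh X).1 hX)
  -- The Leibniz rule with `S X = 0` says that `S` commutes with `ad X`.
  rw [weightMap_lieBr b ρ hgr, h0]
  have : lieBr G 0 x = 0 :=
    zero_lie (L := GroupLieAlgebra 𝓘(ℝ, E) G) (M := GroupLieAlgebra 𝓘(ℝ, E) G) x
  rw [this, zero_add]

/-- `F` is the lower central filtration `K.lcs` of the nilpotent ideal; a vector of nonzero weight
is in `K` because it is a multiple of its image under the diagonal map. -/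
theorem exists_filtration_of_form {ι : Type*} [Fintype ι] (b : Module.Basis ι ℝ E) (ρ : ι → ℝ)
    (hgr : ∀ i j, lieBr G (b i) (b j) ∈ Submodule.span ℝ (b '' {k | ρ k = ρ i + ρ j}))
    {Q : E →ₗ[ℝ] E →ₗ[ℝ] ℝ} (hsymm : ∀ x y, Q x y = Q y x) (hpos : ∀ x, x ≠ 0 → 0 < Q x x)
    (hQD : ∀ x y, Q (weightMap b ρ x) y = Q x (weightMap b ρ y))
    (hskew : ∀ X, weightMap b ρ X = 0 → ∀ y, Q (lieBr G X y) y = 0) :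
    ∃ (K : Submodule ℝ E) (F : ℕ → Submodule ℝ E) (N : ℕ),
      (∀ x, ∀ k ∈ K, lieBr G x k ∈ K) ∧ (∀ i, ρ i ≠ 0 → b i ∈ K) ∧ F 0 = ⊤ ∧ F N = ⊥ ∧
      (∀ n, ∀ k ∈ K, ∀ x ∈ F n, lieBr G k x ∈ F (n + 1)) ∧
      ∀ n, ∀ x ∈ F n, weightMap b ρ x ∈ F n := by
  have hfd : FiniteDimensional ℝ (GroupLieAlgebra 𝓘(ℝ, E) G) :=
    inferInstanceAs (FiniteDimensional ℝ E)
  obtain ⟨K, hDK, N, hN⟩ := exists_nilpotent_lieIdeal (L := GroupLieAlgebra 𝓘(ℝ, E) G) b ρ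
    (weightMap_lieBr b ρ hgr) Q hsymm hpos hQD hskew
  have hlcs := lcs_mem_of_derivation (L := GroupLieAlgebra 𝓘(ℝ, E) G) (weightMap b ρ)
    (weightMap_lieBr b ρ hgr) K hDK
  refine ⟨K.toSubmodule, fun n => (K.lcs (GroupLieAlgebra 𝓘(ℝ, E) G) n).toSubmodule, N,
    fun x k hk => lie_mem_right ℝ (GroupLieAlgebra 𝓘(ℝ, E) G) K x k hk, fun i hi => ?_, rfl, ?_, fun n k hk x hx => ?_, hlcs⟩
  · have h1 := K.toSubmodule.smul_mem (ρ i)⁻¹ (hDK (b i))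
    have h2 : (ρ i)⁻¹ • weightMap b ρ (b i) = b i := by
      rw [weightMap_basis, smul_smul, inv_mul_cancel₀ hi, one_smul]
    exact h2 ▸ h1
  · exact congrArg LieSubmodule.toSubmodule hN
  · exact lie_mem_lcs_succ (L := GroupLieAlgebra 𝓘(ℝ, E) G) K n hk hx

theorem expClosure_le_connectedSubgroup {ι : Type*} {e : ι → E}
    {h : Submodule ℝ (GroupLieAlgebra 𝓘(ℝ, E) G)} (he : ∀ i, e i ∈ h) :
    expClosure G e ≤ connectedSubgroup h := by
  refine (Subgroup.closure_le _).2 ?_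
  rintro _ ⟨i, t, rfl⟩
  exact expCurve_mem_connectedSubgroup (he i) t

end Main

end DerivationSplitting

theorem mainTheorem7
    {E : Type*} [NormedAddCommGroup E] [NormedSpace ℝ E] [FiniteDimensional ℝ E] [CompleteSpace E]
    {G : Type*} [TopologicalSpace G] [T2Space G] [ConnectedSpace G] [ChartedSpace E G] [Group G]
    [LieGroup 𝓘(ℝ, E) ∞ G]
    (D : DerivationSplitting.Derivations E G)
    (hcompact : IsCompact (DerivationSplitting.groupZero D : Set G)) :
    (DerivationSplitting.IsInner D → DerivationSplitting.groupZero D = ⊤) ∧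
    ((DerivationSplitting.groupPlusZero D : Set G) * (DerivationSplitting.groupMinus D : Set G)
        = Set.univ ∧
      (DerivationSplitting.groupMinusZero D : Set G) * (DerivationSplitting.groupPlus D : Set G)
        = Set.univ) := by
  open DerivationSplitting in
  have hfd : FiniteDimensional ℝ (GroupLieAlgebra 𝓘(ℝ, E) G) :=
    inferInstanceAs (FiniteDimensional ℝ E)
  obtain ⟨n, b', ρ, hb'⟩ := exists_spectral_basis D.toLinearMap
  let b : Module.Basis (Fin n) ℝ E := b'
  have hmem : ∀ i s, ρ i ∈ s → b' i ∈ spectralPart D.toLinearMap s := fun i s hi => by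
    rw [hb']; exact Submodule.subset_span ⟨i, hi, rfl⟩
  have hgr : ∀ i j, lieBr G (b i) (b j) ∈ Submodule.span ℝ (b '' {k | ρ k = ρ i + ρ j}) := by
    intro i j
    have h := lie_mem_spectralPart D (hmem i {ρ i} rfl) (hmem j {ρ j} rfl)
    rw [hb'] at h
    exact h
  have hzero : ∀ X : E, X ∈ zeroPart D.toLinearMap ↔
      X ∈ Submodule.span ℝ (b '' {i | ρ i ∈ ({0} : Set ℝ)}) := fun X => by
    have h : X ∈ zeroPart D.toLinearMap ↔ _ := iff_of_eq (congrArg (X ∈ ·) (hb' {0}))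
    exact h
  obtain ⟨Q, hsymm, hpos, hQD, hskew⟩ := exists_form_of_weights b ρ hgr hzero hcompact
  obtain ⟨K, F, N, hKid, hK, hF0, hFN, hKF, hFD⟩ := exists_filtration_of_form b ρ hgr hsymm hpos
    hQD fun X hX => hskew X ((hzero X).2 ((weightMap_eq_zero_iff b ρ X).1 hX))
  refine ⟨?_, ?_, ?_⟩
  · rintro ⟨X, hX⟩
    -- `D X = [X, X] = 0` places `X` in the eigenspace of `0`, hence in `𝔤⁰`, so `ad X = D` is skew
    -- for `Q`.
    have hDX : D X = 0 := by rw [hX, lie_self]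
    have hX0 : X ∈ zeroPart D.toLinearMap := by
      refine mem_spectralPart.2 (mem_complexPart (α := 0) (by simp) ?_)
      rw [Module.End.mem_maxGenEigenspace]
      refine ⟨1, ?_⟩
      rw [pow_one, zero_smul, sub_zero, LinearMap.baseChange_tmul]
      refine (congrArg _ hDX).trans (TensorProduct.tmul_zero _ _)
    have htop : zeroPart D.toLinearMap = ⊤ :=
      spectralPart_zero_of_skew D.toLinearMap Q hsymm hpos fun y =>
        (congrArg (fun z => Q z y) (hX y)).trans (hskew X hX0 y)
    rw [eq_top_iff, ← expClosure_basis_eq_top (G := G) b]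
    refine expClosure_le_connectedSubgroup fun i => ?_
    rw [htop]; trivial
  · have hp : expClosure G (fun i : {i // 0 ≤ ρ i} => b i) ≤ groupPlusZero D := by
      refine expClosure_le_connectedSubgroup fun i => ?_
      rcases i.2.lt_or_eq with h | h
      · exact le_sup_left (a := plusPart D.toLinearMap) (hmem i _ h)
      · exact le_sup_right (b := zeroPart D.toLinearMap) (hmem i _ h.symm)
    have hm : expClosure G (fun i : {i // ρ i < 0} => b i) ≤ groupMinus D :=
      expClosure_le_connectedSubgroup fun i => hmem i _ i.2
    refine Set.eq_univ_of_forall fun g => ?_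
    obtain ⟨p, hp', m, hm', rfl⟩ := exists_mul_eq_of_nilpotent b ρ hgr hKid hK hF0 hFN hKF hFD g
    exact Set.mul_mem_mul (hp hp') (hm hm')
  -- Negating the weights exchanges the two signs; the ideal `K` and its filtration serve unchanged.
  · have hp : expClosure G (fun i : {i // 0 ≤ (-ρ) i} => b i) ≤ groupMinusZero D := by
      refine expClosure_le_connectedSubgroup fun i => ?_
      have hi : ρ i ≤ 0 := neg_nonneg.1 i.2
      rcases hi.lt_or_eq with h | h
      · exact le_sup_left (a := minusPart D.toLinearMap) (hmem i _ h)
      · exact le_sup_right (b := zeroPart D.toLinearMap) (hmem i _ h)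
    have hm : expClosure G (fun i : {i // (-ρ) i < 0} => b i) ≤ groupPlus D :=
      expClosure_le_connectedSubgroup fun i => hmem i _ (neg_lt_zero.1 i.2)
    have hgr' : ∀ i j, lieBr G (b i) (b j) ∈
        Submodule.span ℝ (b '' {k | (-ρ) k = (-ρ) i + (-ρ) j}) := fun i j => by
      have h : {k | (-ρ) k = (-ρ) i + (-ρ) j} = {k | ρ k = ρ i + ρ j} := by
        ext k
        simp only [Pi.neg_apply, Set.mem_ofPred_eq]
        constructor <;> intro h <;> linarith
      rw [h]
      exact hgr i j
    refine Set.eq_univ_of_forall fun g => ?_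
    obtain ⟨p, hp', m, hm', rfl⟩ := exists_mul_eq_of_nilpotent b (-ρ) hgr' hKid
      (fun i hi => hK i fun h => hi (neg_eq_zero.2 h)) hF0 hFN hKF
      (fun n x hx => by rw [weightMap_neg]; exact (F n).neg_mem (hFD n x hx)) g
    exact Set.mul_mem_mul (hp hp') (hm hm')

end
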